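/- **Setting.** Let $n\ge 6$, and let $\mathfrak g=\mathfrak{so}(n+3,3)=\mathfrak g_{-2}\oplus\dots\oplus\mathfrak g_2$ be graded by the parabolic subalgebra stabilising an isotropic $3$-plane in $\mathbb R^{n+3,3}$, so that $\mathfrak g_-=\mathfrak g_{-1}\oplus\mathfrak g_{-2}$, $\mathfrak g_{-1}\cong(\mathbb R^3)^*\otimes\mathbb R^n$, $\mathfrak g_{-2}\cong\Lambda^2(\mathbb R^3)^*$. Let $\mathcal U=\pi(\exp\mathfrak g_-)\subset G/P$ with its coordinates $(x_{i\alpha},x_{ij}=-x_{ji})$, $1\le i,j\le 3$, $1\le\alpha\le n$ (coordinate vector fields $\partial_{i\alpha}$, $\partial_{ij}=-\partial_{ji}$), and its left invariant vector fields $$\xi_{X_{k\mu}}=\partial_{k\mu}-\frac1{2\sqrt{n+2}}\sum_i x_{i\mu}\,\partial_{ki},\qquad \xi_{X_{rs}}=\partial_{rs},$$ and let $\mathcal H\subset T\mathcal U$ be the distribution spanned by the $\xi_{X_{k\mu}}$. Let $\mathbb S$ be a nonzero finite dimensional complex module over the Clifford algebra of $\mathbb R^n$ with $\varepsilon_\alpha\varepsilon_\beta+\varepsilon_\beta\varepsilon_\alpha=-2\delta_{\alpha\beta}$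 (for instance the spinor module $\mathbb S_+\oplus\mathbb S_-$), and put $\partial_i=\sum_\alpha\varepsilon_\alpha\,\xi_{X_{i\alpha}}$. Let $\Gamma$ be the space of smooth functions $f:\mathcal U\to\mathbb S$ which are invariant along $\mathfrak g_{-2}$, i.e. $\xi_Xf=0$ for all $X\in\mathfrak g_{-2}$. Let $V_1,\dots,V_8$ be complex vector spaces of dimensions $1,3,8,6,6,8,3,1$ (the $\mathfrak{gl}_3$-modules $V_{\lambda_1},\dots,V_{\lambda_8}$), with bases indexed as follows: $V_2,V_7$ by $1,2,3$; $V_3,V_6$ by the six pairs $ij$ with $i\neq j$ and two further indices $1,2$; $V_4$ by $220,202,022,211,121,112$; $V_5$ by $311,131,113,221,212,122$. Elements of $\Gamma(V_r):=V_r\otimes\Gamma$ are written in components with respect to these bases. Write $\{\partial_i,\partial_j\}=\partial_i\partial_j+\partial_j\partial_i$ and $[ij]=\partial_i\partial_j+2\partial_j\partial_i$. Consider the diagram $$\begin{array}{ccccccccc}\Gamma(V_1)&\xrightarrow{D_1}&\Gamma(V_2)&\xrightarrow{D_2}&\Gamma(V_3)&\xrightarrow{D_3}&\Gamma(V_4)&&\Gamma(V_8)\\&&&&{\scriptstyle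 D_4}\downarrow&&\downarrow{\scriptstyle D_6}&&\uparrow{\scriptstyle D_8}\\&&&&\Gamma(V_5)&\xrightarrow{D_5}&\Gamma(V_6)&\xrightarrow{D_7}&\Gamma(V_7)\end{array}$$ of operators given by: * $D_1\phi=(\partial_1\phi,\partial_2\phi,\partial_3\phi)$. * $(D_2\phi)_{ij}=\partial_i\partial_i\phi_j-\partial_j\partial_i\phi_i$; $(D_2\phi)_1=\{\partial_2,\partial_3\}\phi_1-\partial_1\partial_3\phi_2-\partial_1\partial_2\phi_3$; $(D_2\phi)_2=\{\partial_1,\partial_3\}\phi_2-\partial_2\partial_3\phi_1-\partial_2\partial_1\phi_3$. * $4D_3\psi$ has components $220:\ -2\partial_1\psi_{21}-2\partial_2\psi_{12}$; $202:\ -2\partial_1\psi_{31}-2\partial_3\psi_{13}$; $022:\ -2\partial_3\psi_{23}-2\partial_2\psi_{32}$; $211:\ -\partial_2\psi_{13}-\partial_3\psi_{12}-\partial_1\psi_1$; $121:\ -\partial_1\psi_{23}-\partial_3\psi_{21}-\partial_2\psi_2$; $112:\ \partial_2\psi_{31}+\partial_1\psi_{32}-\partial_3\psi_1-\partial_3\psi_2$.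 * $8D_4\psi$ has components $311:\ 2\big(\partial_1\partial_1(\psi_1+2\psi_2)+[12]\psi_{13}-[13]\psi_{12}\big)$; $131:\ 2\big(-\partial_2\partial_2(2\psi_1+\psi_2)+[23]\psi_{21}-[21]\psi_{23}\big)$; $113:\ 2\big(\partial_3\partial_3(\psi_1-\psi_2)+[31]\psi_{32}-[32]\psi_{31}\big)$; $221:\ \partial_1(\partial_2\psi_2-3\partial_1\psi_{23})+\partial_2(-\partial_1\psi_1+3\partial_2\psi_{13})+[13]\psi_{21}-[23]\psi_{12}$; $212:\ \partial_1(\partial_3\psi_1+\partial_3\psi_2+3\partial_1\psi_{32})+\partial_3(\partial_1\psi_1-3\partial_3\psi_{12})-[12]\psi_{31}+[32]\psi_{13}$; $122:\ \partial_2(-\partial_3\psi_1-\partial_3\psi_2-3\partial_2\psi_{31})+\partial_3(-\partial_2\psi_2+3\partial_3\psi_{21})+[21]\psi_{32}-[31]\psi_{23}$. * $24D_5\psi$ has components $12:\ \partial_3\psi_{122}-\partial_2\psi_{113}$; $21:\ \partial_3\psi_{212}-\partial_1\psi_{113}$; $13:\ \partial_2\psi_{122}-\partial_3\psi_{131}$;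 $31:\ \partial_2\psi_{221}-\partial_1\psi_{131}$; $23:\ \partial_1\psi_{212}-\partial_3\psi_{311}$; $32:\ \partial_1\psi_{221}-\partial_2\psi_{311}$; $1:\ \partial_1\psi_{122}-\partial_3\psi_{221}$; $2:\ \partial_2\psi_{212}-\partial_3\psi_{221}$. * $48D_6\varphi$ has components $12:\ -[31]\varphi_{022}-[32]\varphi_{112}+3\partial_3\partial_3\varphi_{121}$; $21:\ [32]\varphi_{202}+[31]\varphi_{112}-3\partial_3\partial_3\varphi_{211}$; $13:\ [21]\varphi_{022}-[23]\varphi_{121}+3\partial_2\partial_2\varphi_{112}$; $31:\ -[23]\varphi_{220}+[21]\varphi_{121}+3\partial_2\partial_2\varphi_{211}$; $23:\ -[12]\varphi_{202}+[13]\varphi_{211}-3\partial_1\partial_1\varphi_{112}$; $32:\ [13]\varphi_{220}-[12]\varphi_{211}-3\partial_1\partial_1\varphi_{121}$; $1:\ \partial_1\partial_1\varphi_{022}-2\partial_2\partial_2\varphi_{202}+\partial_3\partial_3\varphi_{220}-\partial_1\partial_2\varphi_{112}-\{\partial_1,\partial_3\}\varphi_{121}+\partial_3\partial_2\varphi_{211}$;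 $2:\ 2\partial_1\partial_1\varphi_{022}-\partial_2\partial_2\varphi_{202}-\partial_3\partial_3\varphi_{220}+\partial_2\partial_1\varphi_{112}-\partial_3\partial_1\varphi_{121}+\{\partial_2,\partial_3\}\varphi_{211}$. * $D_7\varphi$ has components $1:\ \partial_2\partial_2\varphi_{21}-\partial_1\partial_2\varphi_{12}+\partial_3\partial_3\varphi_{31}-\partial_1\partial_3\varphi_{13}+\{\partial_2,\partial_3\}\varphi_1-\partial_3\partial_2\varphi_2$; $2:\ \partial_1\partial_1\varphi_{12}-\partial_2\partial_1\varphi_{21}+\partial_3\partial_3\varphi_{32}-\partial_2\partial_3\varphi_{23}+\{\partial_1,\partial_3\}\varphi_2-\partial_3\partial_1\varphi_1$; $3:\ \partial_1\partial_1\varphi_{13}-\partial_3\partial_1\varphi_{31}+\partial_2\partial_2\varphi_{23}-\partial_3\partial_2\varphi_{32}-\partial_2\partial_1\varphi_1-\partial_1\partial_2\varphi_2$. * $D_8\psi=\partial_1\psi_1+\partial_2\psi_2+\partial_3\psi_3$. **Theorem.** (i) $D_1,D_3,D_5,D_8$ are linear differential operators of order exactly $1$, and $D_2,D_4,D_6,D_7$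 of order exactly $2$. (ii) The diagram is a complex: $D_2D_1=0$, $D_3D_2=0$, $D_4D_2=0$, $D_6D_3+D_5D_4=0$, $D_7D_6=0$, $D_7D_5=0$, $D_8D_7=0$. (iii) The symbol sequence restricted to $\mathcal H$ is exact. For an operator $D$ of order $m$ in the diagram, $x\in\mathcal U$, and a smooth real function $g$ on $\mathcal U$, invariant along $\mathfrak g_{-2}$, with $g(x)=0$, let $\sigma(D)w=\frac1{m!}D(g^mw)(x)$ be the principal symbol of $D$ at the covector $dg_x|_{\mathcal H_x}$. If $dg_x|_{\mathcal H_x}\ne0$, then the sequence $$0\to V_1\otimes\mathbb S\xrightarrow{\sigma(D_1)}V_2\otimes\mathbb S\xrightarrow{\sigma(D_2)}V_3\otimes\mathbb S\xrightarrow{(\sigma(D_3),\sigma(D_4))}(V_4\oplus V_5)\otimes\mathbb S\xrightarrow{\sigma(D_6)+\sigma(D_5)}V_6\otimes\mathbb S\xrightarrow{\sigma(D_7)}V_7\otimes\mathbb S\xrightarrow{\sigma(D_8)}V_8\otimes\mathbb S\to0$$ is exact. -/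

import Mathlib

open scoped ContDiff

namespace ThreeDirac

noncomputable section

/-! ### The affine chart and its left invariant vector fields -/

/-- Index set of the coordinates `x_{ij}`, `1 ≤ i < j ≤ 3`, of `𝔤₋₂ ≅ Λ²(ℝ³)*`. -/
abbrev Pair : Type := {p : Fin 3 × Fin 3 // p.1 < p.2}

/-- The affine open set `𝒰 = π(exp 𝔤₋)` of the homogeneous space `G/P` of isotropic 3-planes in
`ℝ^{n+3,3}`, `𝔤 = 𝔰𝔬(n+3,3) = 𝔤₋₂ ⊕ 𝔤₋₁ ⊕ 𝔤₀ ⊕ 𝔤₁ ⊕ 𝔤₂`, with the canonical coordinates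
`(x_{iα}, x_{ij})` of `𝔤₋ = 𝔤₋₁ ⊕ 𝔤₋₂`, `𝔤₋₁ ≅ (ℝ³)* ⊗ ℝⁿ`, `𝔤₋₂ ≅ Λ²(ℝ³)*`.  Here
`[X_{iα}, X_{jβ}] = δ_{αβ} X_{ij} / √(n+2)`, and `𝔤₋₂` is central. -/
abbrev Chart (n : ℕ) : Type := (Fin 3 → Fin n → ℝ) × (Pair → ℝ)

/-- The coordinate vector `∂_{ij} = -∂_{ji}` (zero for `i = j`) of `𝔤₋₂`. -/
def pairVec (i j : Fin 3) : Pair → ℝ := fun p =>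
  if p.1 = (i, j) then 1 else if p.1 = (j, i) then -1 else 0

/-- The coordinate vector `∂_{iα}` of `𝔤₋₁`. -/
def rowVec {n : ℕ} (i : Fin 3) (α : Fin n) : Fin 3 → Fin n → ℝ := Pi.single i (Pi.single α 1)

/-- The left invariant vector field
`ξ_{X_{kμ}} = ∂_{kμ} - (1 / (2 √(n+2))) ∑ᵢ x_{iμ} ∂_{ki}`. -/
def xiOne {n : ℕ} (k : Fin 3) (μ : Fin n) (x : Chart n) : Chart n :=
  (rowVec k μ, -(1 / (2 * √((n : ℝ) + 2))) • ∑ i, x.1 i μ • pairVec k i)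

/-- The left invariant vector field `ξ_{X_{rs}} = ∂_{rs}`. -/
def xiTwo {n : ℕ} (r s : Fin 3) (_x : Chart n) : Chart n := (0, pairVec r s)

/-- The derivative `ξ.f` of a function along a vector field. -/
def lieDeriv {n : ℕ} {W : Type*} [NormedAddCommGroup W] [NormedSpace ℝ W]
    (ξ : Chart n → Chart n) (f : Chart n → W) : Chart n → W :=
  fun x => fderiv ℝ f x (ξ x)

/-- The fibre at `x` of the distribution `ℋ`, spanned by the fields `ξ_{X_{kμ}}`. -/
def horizontal {n : ℕ} (x : Chart n) : Submodule ℝ (Chart n) :=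
  Submodule.span ℝ {v | ∃ (k : Fin 3) (μ : Fin n), v = xiOne k μ x}

/-! ### Sections invariant along `𝔤₋₂` -/

/-- Smooth functions on the chart with `ξ_X f = 0` for all `X ∈ 𝔤₋₂`. -/
def IsInvariant {n : ℕ} {W : Type*} [NormedAddCommGroup W] [NormedSpace ℝ W]
    (f : Chart n → W) : Prop :=
  ContDiff ℝ ∞ f ∧ ∀ r s : Fin 3, lieDeriv (xiTwo r s) f = 0

section Invariant

variable {n : ℕ} {W W' : Type*} [NormedAddCommGroup W] [NormedSpace ℝ W]
  [NormedAddCommGroup W'] [NormedSpace ℝ W']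

theorem IsInvariant.diff {f : Chart n → W} (hf : IsInvariant f) : Differentiable ℝ f :=
  hf.1.differentiable (by simp)

theorem IsInvariant.const (w : W) : IsInvariant (fun _ : Chart n => w) :=
  ⟨contDiff_const, fun r s => by funext x; simp [lieDeriv]⟩

theorem IsInvariant.add {f g : Chart n → W} (hf : IsInvariant f) (hg : IsInvariant g) :
    IsInvariant (f + g) := by
  refine ⟨hf.1.add hg.1, fun r s => ?_⟩
  funext x
  have h1 := congrFun (hf.2 r s) x
  have h2 := congrFun (hg.2 r s) x
  simp only [lieDeriv, Pi.zero_apply] at h1 h2 ⊢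
  rw [fderiv_add (hf.diff x) (hg.diff x)]
  simp [h1, h2]

theorem IsInvariant.clm {f : Chart n → W} (hf : IsInvariant f) (L : W →L[ℝ] W') :
    IsInvariant (fun x => L (f x)) := by
  refine ⟨L.contDiff.comp hf.1, fun r s => ?_⟩
  funext x
  have h1 := congrFun (hf.2 r s) x
  simp only [lieDeriv, Pi.zero_apply] at h1 ⊢
  have : fderiv ℝ (fun y => L (f y)) x = L.comp (fderiv ℝ f x) :=
    (L.hasFDerivAt.comp x (hf.diff x).hasFDerivAt).fderiv
  rw [this]
  simp [h1]

theorem IsInvariant.smul {g : Chart n → ℝ} {f : Chart n → W} (hg : IsInvariant g)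
    (hf : IsInvariant f) : IsInvariant (fun x => g x • f x) := by
  refine ⟨hg.1.smul hf.1, fun r s => ?_⟩
  funext x
  have h1 := congrFun (hf.2 r s) x
  have h2 := congrFun (hg.2 r s) x
  simp only [lieDeriv, Pi.zero_apply] at h1 h2 ⊢
  rw [fderiv_fun_smul (hg.diff x) (hf.diff x)]
  simp [h1, h2]

/-- The fields `ξ_{X_{kμ}}` preserve invariance along `𝔤₋₂`. -/
theorem IsInvariant.xiOne {f : Chart n → W} (hf : IsInvariant f) (k : Fin 3) (μ : Fin n) :
    IsInvariant (lieDeriv (xiOne k μ) f) := by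
  have hrow : lieDeriv (ThreeDirac.xiOne k μ) f = fun x => fderiv ℝ f x (rowVec k μ, 0) := by
    funext x
    have hsplit : ThreeDirac.xiOne k μ x = (rowVec k μ, 0) +
        (-(1 / (2 * √((n : ℝ) + 2)))) • ∑ i, x.1 i μ • xiTwo k i x := by
      ext <;> simp [ThreeDirac.xiOne, xiTwo, Prod.fst_sum, Prod.snd_sum]
    have h0 : ∀ i, fderiv ℝ f x (xiTwo k i x) = 0 := fun i => congrFun (hf.2 k i) x
    simp only [lieDeriv]
    rw [hsplit, map_add, map_smul, map_sum]
    simp [h0]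
  rw [hrow]
  have hsm : ContDiff ℝ ∞ (fderiv ℝ f) := hf.1.fderiv_right (by simp)
  refine ⟨hsm.clm_apply contDiff_const, fun r s => ?_⟩
  funext x
  simp only [lieDeriv, Pi.zero_apply]
  have hd : DifferentiableAt ℝ (fderiv ℝ f) x := (hsm.differentiable (by simp)) x
  have e1 : ∀ u v : Chart n, fderiv ℝ (fun y => fderiv ℝ f y u) x v
      = fderiv ℝ (fderiv ℝ f) x v u := by
    intro u v
    rw [fderiv_clm_apply hd (differentiableAt_const u)]
    simp
  have hsymm : IsSymmSndFDerivAt ℝ f x :=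
    hf.1.contDiffAt.isSymmSndFDerivAt (by
      rw [minSmoothness_of_isRCLikeNormedField]; exact WithTop.coe_le_coe.2 (le_top : (2 : ℕ∞) ≤ ⊤))
  rw [e1, hsymm.eq, ← e1]
  have h0 : (fun y => fderiv ℝ f y (xiTwo r s x)) = fun _ => 0 := funext fun y =>
    congrFun (hf.2 r s) y
  rw [h0]
  simp

end Invariant

/-- The algebra of smooth real functions on the chart that are invariant along `𝔤₋₂`. -/
def invFunctions (n : ℕ) : Subalgebra ℝ (Chart n → ℝ) where
  carrier := {g | IsInvariant g}
  mul_mem' := fun ha hb => IsInvariant.smul ha hb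
  add_mem' := fun ha hb => ha.add hb
  algebraMap_mem' := fun r => IsInvariant.const r

section Sections

variable {n : ℕ} {S : Type*} [NormedAddCommGroup S] [NormedSpace ℂ S]

/-- Smooth `S`-valued functions on the chart that are invariant along `𝔤₋₂`.  In the gauge
`π(exp X) ↦ exp X` a section of `𝒱_λ ⊗ 𝒮` over `𝒰` is a `V_λ ⊗ S`-valued function on `𝒰`, hence a
family of such functions, its components in a basis of `V_λ`. -/
def invSections (n : ℕ) (S : Type*) [NormedAddCommGroup S] [NormedSpace ℂ S] :
    Submodule ℂ (Chart n → S) where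
  carrier := {f | IsInvariant f}
  add_mem' := fun ha hb => ha.add hb
  zero_mem' := IsInvariant.const 0
  smul_mem' := fun c f hf => by
    have h : IsInvariant f := hf
    exact h.clm ((c • ContinuousLinearMap.id ℂ S).restrictScalars ℝ)

/-- The constant section. -/
def constSection (n : ℕ) (w : S) : invSections n S := ⟨fun _ => w, IsInvariant.const w⟩

/-- The product of an invariant function and an invariant section. -/
def mulSection (g : invFunctions n) (s : invSections n S) : invSections n S :=
  ⟨fun x => g.1 x • s.1 x, IsInvariant.smul g.2 s.2⟩

end Sections

/-! ### The Dirac operators `∂₁, ∂₂, ∂₃` -/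

/-- The form with `ε_α ε_β + ε_β ε_α = -2 δ_{αβ}` in its Clifford algebra. -/
def cliffordForm (n : ℕ) : QuadraticForm ℝ (Fin n → ℝ) :=
  QuadraticMap.weightedSumSquares ℝ (fun _ : Fin n => (-1 : ℝ))

/-- The Clifford number `ε_α`. -/
def cliffordGen {n : ℕ} (α : Fin n) : CliffordAlgebra (cliffordForm n) :=
  CliffordAlgebra.ι (cliffordForm n) (Pi.single α 1)

section Dirac

variable {n : ℕ} {S : Type*} [NormedAddCommGroup S] [NormedSpace ℂ S] [FiniteDimensional ℂ S]

/-- `∂_i f = ∑_α ε_α (ξ_{X_{iα}}.f)`, on sections with values in a Clifford module. -/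
def dirac (ρ : CliffordAlgebra (cliffordForm n) →ₐ[ℝ] Module.End ℂ S) (i : Fin 3) :
    Module.End ℂ (invSections n S) where
  toFun f := ⟨fun x => ∑ α : Fin n, ρ (cliffordGen α) (lieDeriv (xiOne i α) f.1 x), by
    have key : ∀ t : Finset (Fin n), IsInvariant
        (fun x => ∑ α ∈ t, ρ (cliffordGen α) (lieDeriv (xiOne i α) f.1 x)) := by
      classical
      intro t
      induction t using Finset.induction_on with
      | empty => simpa using IsInvariant.const (n := n) (0 : S)
      | insert a t ha ih =>
        have h := ((IsInvariant.xiOne f.2 i a).clm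
          ((LinearMap.toContinuousLinearMap (ρ (cliffordGen a))).restrictScalars ℝ)).add ih
        refine cast (congrArg IsInvariant ?_) h
        funext x
        simp [Finset.sum_insert ha]
    exact key Finset.univ⟩
  map_add' f g := by
    apply Subtype.ext
    funext x
    have hf : DifferentiableAt ℝ f.1 x := IsInvariant.diff f.2 x
    have hg : DifferentiableAt ℝ g.1 x := IsInvariant.diff g.2 x
    simp [lieDeriv, fderiv_add hf hg, Finset.sum_add_distrib]
  map_smul' c f := by
    apply Subtype.ext
    funext x
    have hf : DifferentiableAt ℝ f.1 x := IsInvariant.diff f.2 x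
    simp [lieDeriv, fderiv_const_smul hf c, Finset.smul_sum]

end Dirac

/-! ### Bases of the modules `V_λ` -/

/-- The basis `h_{ij} = e_i ∧ e_j ⊗ e_i` (`i ≠ j`), `w₁`, `w₂` of `V_{λ₃}`; also the dual basis
of `V_{λ₆}`. -/
inductive Basis3 : Type
  | h12 | h21 | h13 | h31 | h23 | h32 | w1 | w2

/-- The basis of weight vectors of `V_{λ₄}`. -/
inductive Basis4 : Type
  | v220 | v202 | v022 | v211 | v121 | v112

/-- The basis of weight vectors of `V_{λ₅}`. -/
inductive Basis5 : Type
  | w311 | w131 | w113 | w221 | w212 | w122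

/-! ### The operators, in terms of three endomorphisms `d 0 = ∂₁`, `d 1 = ∂₂`, `d 2 = ∂₃` -/

section Operators

variable {M : Type*} [AddCommGroup M] [Module ℂ M]

/-- `Γ(V_{λ₁}) → Γ(V_{λ₂})`, of first order. -/
def D₁ (d : Fin 3 → Module.End ℂ M) (φ : Unit → M) : Fin 3 → M :=
  ![d 0 (φ ()), d 1 (φ ()), d 2 (φ ())]

/-- `Γ(V_{λ₂}) → Γ(V_{λ₃})`, of second order. -/
def D₂ (d : Fin 3 → Module.End ℂ M) (φ : Fin 3 → M) : Basis3 → M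
  | .h12 => d 0 (d 0 (φ 1)) - d 1 (d 0 (φ 0))
  | .h21 => d 1 (d 1 (φ 0)) - d 0 (d 1 (φ 1))
  | .h13 => d 0 (d 0 (φ 2)) - d 2 (d 0 (φ 0))
  | .h31 => d 2 (d 2 (φ 0)) - d 0 (d 2 (φ 2))
  | .h23 => d 1 (d 1 (φ 2)) - d 2 (d 1 (φ 1))
  | .h32 => d 2 (d 2 (φ 1)) - d 1 (d 2 (φ 2))
  | .w1 => (d 1 (d 2 (φ 0)) + d 2 (d 1 (φ 0))) - d 0 (d 2 (φ 1)) - d 0 (d 1 (φ 2))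
  | .w2 => (d 0 (d 2 (φ 1)) + d 2 (d 0 (φ 1))) - d 1 (d 2 (φ 0)) - d 1 (d 0 (φ 2))

/-- `Γ(V_{λ₃}) → Γ(V_{λ₄})`, of first order. -/
def D₃ (d : Fin 3 → Module.End ℂ M) (ψ : Basis3 → M) : Basis4 → M
  | .v220 => (2 / 4 : ℂ) • (-d 0 (ψ .h21) - d 1 (ψ .h12))
  | .v202 => (2 / 4 : ℂ) • (-d 0 (ψ .h31) - d 2 (ψ .h13))
  | .v022 => (2 / 4 : ℂ) • (-d 2 (ψ .h23) - d 1 (ψ .h32))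
  | .v211 => (1 / 4 : ℂ) • (-d 1 (ψ .h13) - d 2 (ψ .h12) - d 0 (ψ .w1))
  | .v121 => (1 / 4 : ℂ) • (-d 0 (ψ .h23) - d 2 (ψ .h21) - d 1 (ψ .w2))
  | .v112 => (1 / 4 : ℂ) • (d 1 (ψ .h31) + d 0 (ψ .h32) - d 2 (ψ .w1) - d 2 (ψ .w2))

/-- `Γ(V_{λ₃}) → Γ(V_{λ₅})`, of second order. -/
def D₄ (d : Fin 3 → Module.End ℂ M) (ψ : Basis3 → M) : Basis5 → M
  | .w311 => (2 / 8 : ℂ) • (d 0 (d 0 (ψ .w1 + (2 : ℂ) • ψ .w2))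
      + ((2 : ℂ) • d 1 (d 0 (ψ .h13)) + d 0 (d 1 (ψ .h13)))
      - (d 0 (d 2 (ψ .h12)) + (2 : ℂ) • d 2 (d 0 (ψ .h12))))
  | .w131 => (2 / 8 : ℂ) • (-d 1 (d 1 ((2 : ℂ) • ψ .w1 + ψ .w2))
      + (d 1 (d 2 (ψ .h21)) + (2 : ℂ) • d 2 (d 1 (ψ .h21)))
      - (d 1 (d 0 (ψ .h23)) + (2 : ℂ) • d 0 (d 1 (ψ .h23))))
  | .w113 => (2 / 8 : ℂ) • (d 2 (d 2 (ψ .w1 - ψ .w2))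
      + (d 2 (d 0 (ψ .h32)) + (2 : ℂ) • d 0 (d 2 (ψ .h32)))
      - (d 2 (d 1 (ψ .h31)) + (2 : ℂ) • d 1 (d 2 (ψ .h31))))
  | .w221 => (1 / 8 : ℂ) • (d 0 (d 1 (ψ .w2) - (3 : ℂ) • d 0 (ψ .h23))
      + d 1 (-d 0 (ψ .w1) + (3 : ℂ) • d 1 (ψ .h13))
      + (d 0 (d 2 (ψ .h21)) + (2 : ℂ) • d 2 (d 0 (ψ .h21)))
      - (d 1 (d 2 (ψ .h12)) + (2 : ℂ) • d 2 (d 1 (ψ .h12))))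
  | .w212 => (1 / 8 : ℂ) • (d 0 (d 2 (ψ .w1) + d 2 (ψ .w2) + (3 : ℂ) • d 0 (ψ .h32))
      + d 2 (d 0 (ψ .w1) - (3 : ℂ) • d 2 (ψ .h12))
      - (d 0 (d 1 (ψ .h31)) + (2 : ℂ) • d 1 (d 0 (ψ .h31)))
      + (d 2 (d 1 (ψ .h13)) + (2 : ℂ) • d 1 (d 2 (ψ .h13))))
  | .w122 => (1 / 8 : ℂ) • (d 1 (-d 2 (ψ .w1) - d 2 (ψ .w2) - (3 : ℂ) • d 1 (ψ .h31))
      + d 2 (-d 1 (ψ .w2) + (3 : ℂ) • d 2 (ψ .h21))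
      + (d 1 (d 0 (ψ .h32)) + (2 : ℂ) • d 0 (d 1 (ψ .h32)))
      - (d 2 (d 0 (ψ .h23)) + (2 : ℂ) • d 0 (d 2 (ψ .h23))))

/-- `Γ(V_{λ₅}) → Γ(V_{λ₆})`, of first order. -/
def D₅ (d : Fin 3 → Module.End ℂ M) (ψ : Basis5 → M) : Basis3 → M
  | .h12 => (1 / 24 : ℂ) • (d 2 (ψ .w122) - d 1 (ψ .w113))
  | .h21 => (1 / 24 : ℂ) • (d 2 (ψ .w212) - d 0 (ψ .w113))
  | .h13 => (1 / 24 : ℂ) • (d 1 (ψ .w122) - d 2 (ψ .w131))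
  | .h31 => (1 / 24 : ℂ) • (d 1 (ψ .w221) - d 0 (ψ .w131))
  | .h23 => (1 / 24 : ℂ) • (d 0 (ψ .w212) - d 2 (ψ .w311))
  | .h32 => (1 / 24 : ℂ) • (d 0 (ψ .w221) - d 1 (ψ .w311))
  | .w1 => (1 / 24 : ℂ) • (d 0 (ψ .w122) - d 2 (ψ .w221))
  | .w2 => (1 / 24 : ℂ) • (d 1 (ψ .w212) - d 2 (ψ .w221))

/-- `Γ(V_{λ₄}) → Γ(V_{λ₆})`, of second order. -/
def D₆ (d : Fin 3 → Module.End ℂ M) (φ : Basis4 → M) : Basis3 → M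
  | .h12 => (1 / 48 : ℂ) • (-(d 2 (d 0 (φ .v022)) + (2 : ℂ) • d 0 (d 2 (φ .v022)))
      - (d 2 (d 1 (φ .v112)) + (2 : ℂ) • d 1 (d 2 (φ .v112))) + (3 : ℂ) • d 2 (d 2 (φ .v121)))
  | .h21 => (1 / 48 : ℂ) • ((d 2 (d 1 (φ .v202)) + (2 : ℂ) • d 1 (d 2 (φ .v202)))
      + (d 2 (d 0 (φ .v112)) + (2 : ℂ) • d 0 (d 2 (φ .v112))) - (3 : ℂ) • d 2 (d 2 (φ .v211)))
  | .h13 => (1 / 48 : ℂ) • (((2 : ℂ) • d 0 (d 1 (φ .v022)) + d 1 (d 0 (φ .v022)))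
      - (d 1 (d 2 (φ .v121)) + (2 : ℂ) • d 2 (d 1 (φ .v121))) + (3 : ℂ) • d 1 (d 1 (φ .v112)))
  | .h31 => (1 / 48 : ℂ) • (-(d 1 (d 2 (φ .v220)) + (2 : ℂ) • d 2 (d 1 (φ .v220)))
      + (d 1 (d 0 (φ .v121)) + (2 : ℂ) • d 0 (d 1 (φ .v121))) + (3 : ℂ) • d 1 (d 1 (φ .v211)))
  | .h23 => (1 / 48 : ℂ) • (-(d 0 (d 1 (φ .v202)) + (2 : ℂ) • d 1 (d 0 (φ .v202)))
      + (d 0 (d 2 (φ .v211)) + (2 : ℂ) • d 2 (d 0 (φ .v211))) - (3 : ℂ) • d 0 (d 0 (φ .v112)))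
  | .h32 => (1 / 48 : ℂ) • ((d 0 (d 2 (φ .v220)) + (2 : ℂ) • d 2 (d 0 (φ .v220)))
      - (d 0 (d 1 (φ .v211)) + (2 : ℂ) • d 1 (d 0 (φ .v211))) - (3 : ℂ) • d 0 (d 0 (φ .v121)))
  | .w1 => (1 / 48 : ℂ) • (d 0 (d 0 (φ .v022)) - (2 : ℂ) • d 1 (d 1 (φ .v202)) + d 2 (d 2 (φ .v220))
      - d 0 (d 1 (φ .v112)) - (d 0 (d 2 (φ .v121)) + d 2 (d 0 (φ .v121))) + d 2 (d 1 (φ .v211)))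
  | .w2 => (1 / 48 : ℂ) • ((2 : ℂ) • d 0 (d 0 (φ .v022)) - d 1 (d 1 (φ .v202)) - d 2 (d 2 (φ .v220))
      + d 1 (d 0 (φ .v112)) - d 2 (d 0 (φ .v121)) + (d 2 (d 1 (φ .v211)) + d 1 (d 2 (φ .v211))))

/-- `Γ(V_{λ₆}) → Γ(V_{λ₇})`, of second order. -/
def D₇ (d : Fin 3 → Module.End ℂ M) (φ : Basis3 → M) : Fin 3 → M :=
  ![d 1 (d 1 (φ .h21)) - d 0 (d 1 (φ .h12)) + d 2 (d 2 (φ .h31)) - d 0 (d 2 (φ .h13))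
      + (d 1 (d 2 (φ .w1)) + d 2 (d 1 (φ .w1))) - d 2 (d 1 (φ .w2)),
    d 0 (d 0 (φ .h12)) - d 1 (d 0 (φ .h21)) + d 2 (d 2 (φ .h32)) - d 1 (d 2 (φ .h23))
      + (d 0 (d 2 (φ .w2)) + d 2 (d 0 (φ .w2))) - d 2 (d 0 (φ .w1)),
    d 0 (d 0 (φ .h13)) - d 2 (d 0 (φ .h31)) + d 1 (d 1 (φ .h23)) - d 2 (d 1 (φ .h32))
      - d 1 (d 0 (φ .w1)) - d 0 (d 1 (φ .w2))]

/-- `Γ(V_{λ₇}) → Γ(V_{λ₈})`, of first order. -/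
def D₈ (d : Fin 3 → Module.End ℂ M) (ψ : Fin 3 → M) : Unit → M :=
  fun _ => d 0 (ψ 0) + d 1 (ψ 1) + d 2 (ψ 2)

end Operators

/-! ### Order and principal symbol -/

section Symbol

variable {n : ℕ} {S : Type*} [NormedAddCommGroup S] [NormedSpace ℂ S] {ι κ : Type*}

/-- The principal symbol of an operator `D` of order `m` at the covector `dg_x` (`g x = 0`):
the map `w ↦ (1 / m!) D(gᵐ w)(x)` from the source fibre to the target fibre. -/
def symbol (D : (ι → invSections n S) → (κ → invSections n S)) (m : ℕ) (x : Chart n)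
    (g : invFunctions n) (w : ι → S) : κ → S :=
  fun r => ((m.factorial : ℝ)⁻¹) •
    (D (fun i => mulSection (g ^ m) (constSection n (w i))) r).1 x

/-- `D` is a linear differential operator of order exactly `m`: `D(g^{m+1} s)` vanishes wherever
`g` does, and the symbol of order `m` is not identically zero. -/
def HasOrder (D : (ι → invSections n S) → (κ → invSections n S)) (m : ℕ) : Prop :=
  IsLinearMap ℂ D ∧
  (∀ (x : Chart n) (g : invFunctions n), g.1 x = 0 → ∀ (s : ι → invSections n S) (r : κ),
    (D (fun i => mulSection (g ^ (m + 1)) (s i)) r).1 x = 0) ∧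
  ∃ (x : Chart n) (g : invFunctions n) (w : ι → S), g.1 x = 0 ∧ symbol D m x g w ≠ 0

end Symbol

end

end ThreeDirac

/-! Everything reduces to algebra with three endomorphisms `d 0`, `d 1`, `d 2` whose anticommutators
are central, in two incarnations. On sections invariant along 𝔤₋₂ the horizontal fields act as
coordinate derivatives and commute, so the Clifford relations give {∂_i, ∂_j} = -2 ∑_α ξ_{iα}
ξ_{jα}, which commutes with every ∂_k (`centralAnticomm_dirac`). On the fibre S, Clifford
multiplication A_i by the row (ξ_{iα} g)_α has scalar anticommutators (`centralAnticomm_symbolEnd`).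

The complex property is then formal: each composite is a combination of words in the `d i` that
cancels once the words are ordered, using only the centrality of the anticommutators.

Each D_r is homogeneous of degree 1 or 2 in the ∂_i. By the Leibniz rule its symbol is therefore the
same formula with A_i in place of ∂_i, which also yields the exact orders. If dg does not vanish on
ℋ_x, some A_k satisfies A_k² = -c with c > 0 and is invertible (`symbolEnd_bijective`).

It remains to show that the formal complex on S is exact when one `d k` is bijective. This is
elimination: at each spot the image of the incoming map can be used to normalise certain components
to zero, and on such elements the outgoing equations are triangular with leading terms `d k` or `d k
∘ d k`. In units of dim S, the ranks of the six maps are 1, 2, 6, 6, 2, 1. `exact_of_transversal`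
packages the argument, and no inverse of the other two endomorphisms is needed. -/

namespace ThreeDirac

/-- All anticommutators of the family `d` are central in the algebra generated by `d`. -/
def CentralAnticomm {M : Type*} [AddCommGroup M] [Module ℂ M] (d : Fin 3 → Module.End ℂ M) : Prop :=
  ∀ i j k, Commute (d i * d j + d j * d i) (d k)

/-! ### Composition identities from central anticommutators -/

section Complex

variable {M : Type*} [AddCommGroup M] [Module ℂ M] {d : Fin 3 → Module.End ℂ M}

/-- A rewriting system bringing words in `d 0, d 1, d 2` into normal form. -/
theorem CentralAnticomm.exists_normal_form (h : CentralAnticomm d) :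
    ∃ a b c e f g : Module.End ℂ M,
      (∀ x, d 0 (d 0 x) = a x) ∧ (∀ x, d 1 (d 1 x) = b x) ∧ (∀ x, d 2 (d 2 x) = c x) ∧
      (∀ x, d 1 (d 0 x) = e x - d 0 (d 1 x)) ∧ (∀ x, d 2 (d 0 x) = f x - d 0 (d 2 x)) ∧
      (∀ x, d 2 (d 1 x) = g x - d 1 (d 2 x)) ∧
      (∀ k x, d k (a x) = a (d k x)) ∧ (∀ k x, d k (b x) = b (d k x)) ∧
      (∀ k x, d k (c x) = c (d k x)) ∧ (∀ k x, d k (e x) = e (d k x)) ∧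
      (∀ k x, d k (f x) = f (d k x)) ∧ (∀ k x, d k (g x) = g (d k x)) ∧
      (∀ x, b (a x) = a (b x)) ∧ (∀ x, c (a x) = a (c x)) ∧ (∀ x, c (b x) = b (c x)) ∧
      (∀ x, e (a x) = a (e x)) ∧ (∀ x, e (b x) = b (e x)) ∧ (∀ x, e (c x) = c (e x)) ∧
      (∀ x, f (a x) = a (f x)) ∧ (∀ x, f (b x) = b (f x)) ∧ (∀ x, f (c x) = c (f x)) ∧
      (∀ x, f (e x) = e (f x)) ∧
      (∀ x, g (a x) = a (g x)) ∧ (∀ x, g (b x) = b (g x)) ∧ (∀ x, g (c x) = c (g x)) ∧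
      (∀ x, g (e x) = e (g x)) ∧ (∀ x, g (f x) = f (g x)) := by
  -- The anticommutator of `d i` with itself is twice its square, so squares are central after
  -- halving.
  have hsq : ∀ i k, Commute (d i * d i) (d k) := fun i k => by
    have h2 : (d i * d i + d i * d i) = (2 : ℂ) • (d i * d i) := (two_smul ℂ _).symm
    have h1 := (h i i k).smul_left (2⁻¹ : ℂ)
    rwa [h2, smul_smul, inv_mul_cancel₀ two_ne_zero, one_smul] at h1
  have app : ∀ {u v : Module.End ℂ M}, Commute u v → ∀ x, u (v x) = v (u x) :=
    fun huv x => LinearMap.congr_fun huv.eq x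
  have hss : ∀ i j, Commute (d i * d i) (d j * d j) := fun i j => (hsq i j).mul_right (hsq i j)
  have has : ∀ i j k, Commute (d i * d j + d j * d i) (d k * d k) :=
    fun i j k => (h i j k).mul_right (h i j k)
  have haa : ∀ i j k l, Commute (d i * d j + d j * d i) (d k * d l + d l * d k) :=
    fun i j k l => ((h i j k).mul_right (h i j l)).add_right ((h i j l).mul_right (h i j k))
  refine ⟨d 0 * d 0, d 1 * d 1, d 2 * d 2, d 0 * d 1 + d 1 * d 0, d 0 * d 2 + d 2 * d 0,
    d 1 * d 2 + d 2 * d 1, fun _ => rfl, fun _ => rfl, fun _ => rfl, ?_, ?_, ?_,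
    fun k => app (hsq 0 k).symm, fun k => app (hsq 1 k).symm, fun k => app (hsq 2 k).symm,
    fun k => app (h 0 1 k).symm, fun k => app (h 0 2 k).symm, fun k => app (h 1 2 k).symm,
    app (hss 1 0), app (hss 2 0), app (hss 2 1), app (has 0 1 0), app (has 0 1 1), app (has 0 1 2),
    app (has 0 2 0), app (has 0 2 1), app (has 0 2 2), app (haa 0 2 0 1),
    app (has 1 2 0), app (has 1 2 1), app (has 1 2 2), app (haa 1 2 0 1), app (haa 1 2 0 2)⟩ <;>
  · intro x
    simp

/-- Here and in the six identities below, the equations of the normal form act as rewrite rules of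
Poincaré–Birkhoff–Witt type: central letters move outward in alphabetical order, squares become
central letters, and the remaining `d i` end with increasing indices. In normal form only a
comparison of coefficients is left, which `module` performs. -/
theorem D₂_comp_D₁ (h : CentralAnticomm d) (φ : Unit → M) : D₂ d (D₁ d φ) = 0 := by
  obtain ⟨a, b, c, e, f, g, h1, h2, h3, h4, h5, h6, h7, h8, h9, h10, h11, h12, h13, h14, h15, h16,
    h17, h18, h19, h20, h21, h22, h23, h24, h25, h26, h27⟩ := h.exists_normal_form
  funext r
  cases r <;>
  · simp [D₂, D₁, *]
    try module

theorem D₃_comp_D₂ (h : CentralAnticomm d) (φ : Fin 3 → M) : D₃ d (D₂ d φ) = 0 := by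
  obtain ⟨a, b, c, e, f, g, h1, h2, h3, h4, h5, h6, h7, h8, h9, h10, h11, h12, h13, h14, h15, h16,
    h17, h18, h19, h20, h21, h22, h23, h24, h25, h26, h27⟩ := h.exists_normal_form
  funext r
  cases r <;>
  · simp only [D₃, D₂, map_add, map_sub, Pi.zero_apply, *]
    module

theorem D₄_comp_D₂ (h : CentralAnticomm d) (φ : Fin 3 → M) : D₄ d (D₂ d φ) = 0 := by
  obtain ⟨a, b, c, e, f, g, h1, h2, h3, h4, h5, h6, h7, h8, h9, h10, h11, h12, h13, h14, h15, h16,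
    h17, h18, h19, h20, h21, h22, h23, h24, h25, h26, h27⟩ := h.exists_normal_form
  funext r
  cases r <;>
  · simp only [D₄, D₂, map_add, map_sub, map_neg, map_smul, Pi.zero_apply, *]
    module

theorem D₆_comp_D₃_add_D₅_comp_D₄ (h : CentralAnticomm d) (ψ : Basis3 → M) :
    D₆ d (D₃ d ψ) + D₅ d (D₄ d ψ) = 0 := by
  obtain ⟨a, b, c, e, f, g, h1, h2, h3, h4, h5, h6, h7, h8, h9, h10, h11, h12, h13, h14, h15, h16,
    h17, h18, h19, h20, h21, h22, h23, h24, h25, h26, h27⟩ := h.exists_normal_form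
  funext r
  cases r <;>
  · simp only [D₆, D₅, D₄, D₃, map_add, map_sub, map_neg, map_smul, Pi.zero_apply, Pi.add_apply, *]
    module

theorem D₇_comp_D₆ (h : CentralAnticomm d) (φ : Basis4 → M) : D₇ d (D₆ d φ) = 0 := by
  obtain ⟨a, b, c, e, f, g, h1, h2, h3, h4, h5, h6, h7, h8, h9, h10, h11, h12, h13, h14, h15, h16,
    h17, h18, h19, h20, h21, h22, h23, h24, h25, h26, h27⟩ := h.exists_normal_form
  funext r
  fin_cases r <;>
  · simp only [D₇, D₆, map_add, map_sub, map_neg, map_smul, Pi.zero_apply, Fin.zero_eta, Fin.mk_one,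
      Fin.reduceFinMk, Matrix.cons_val, *]
    module

theorem D₇_comp_D₅ (h : CentralAnticomm d) (ψ : Basis5 → M) : D₇ d (D₅ d ψ) = 0 := by
  obtain ⟨a, b, c, e, f, g, h1, h2, h3, h4, h5, h6, h7, h8, h9, h10, h11, h12, h13, h14, h15, h16,
    h17, h18, h19, h20, h21, h22, h23, h24, h25, h26, h27⟩ := h.exists_normal_form
  funext r
  fin_cases r <;>
  · simp only [D₇, D₅, map_sub, map_smul, Pi.zero_apply, Fin.zero_eta, Fin.mk_one,
      Fin.reduceFinMk, Matrix.cons_val, *]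
    module

theorem D₈_comp_D₇ (h : CentralAnticomm d) (φ : Basis3 → M) : D₈ d (D₇ d φ) = 0 := by
  obtain ⟨a, b, c, e, f, g, h1, h2, h3, h4, h5, h6, h7, h8, h9, h10, h11, h12, h13, h14, h15, h16,
    h17, h18, h19, h20, h21, h22, h23, h24, h25, h26, h27⟩ := h.exists_normal_form
  funext r
  simp only [D₈, D₇, map_add, map_sub, Pi.zero_apply, Matrix.cons_val, *]
  module

end Complex
end ThreeDirac

namespace ThreeDirac

/-! ### Linearity of the operators and a criterion for exactness -/

section Linear

variable {M : Type*} [AddCommGroup M] [Module ℂ M] (d : Fin 3 → Module.End ℂ M)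

theorem isLinearMap_D₁ : IsLinearMap ℂ (D₁ d) := by
  constructor <;> intros <;> funext r <;> fin_cases r <;> simp [D₁]

theorem isLinearMap_D₂ : IsLinearMap ℂ (D₂ d) := by
  constructor <;> intros <;> funext r <;> cases r <;>
  · simp only [D₂, map_add, map_smul, Pi.add_apply, Pi.smul_apply]
    module

theorem isLinearMap_D₃ : IsLinearMap ℂ (D₃ d) := by
  constructor <;> intros <;> funext r <;> cases r <;>
  · simp only [D₃, map_add, map_smul, Pi.add_apply, Pi.smul_apply]
    module

theorem isLinearMap_D₄ : IsLinearMap ℂ (D₄ d) := by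
  constructor <;> intros <;> funext r <;> cases r <;>
  · simp only [D₄, map_add, map_sub, map_neg, map_smul, Pi.add_apply, Pi.smul_apply]
    module

theorem isLinearMap_D₅ : IsLinearMap ℂ (D₅ d) := by
  constructor <;> intros <;> funext r <;> cases r <;>
  · simp only [D₅, map_add, map_smul, Pi.add_apply, Pi.smul_apply]
    module

theorem isLinearMap_D₆ : IsLinearMap ℂ (D₆ d) := by
  constructor <;> intros <;> funext r <;> cases r <;>
  · simp only [D₆, map_add, map_smul, Pi.add_apply, Pi.smul_apply]
    module

theorem isLinearMap_D₇ : IsLinearMap ℂ (D₇ d) := by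
  constructor <;> intros <;> funext r <;> fin_cases r <;>
  · simp only [D₇, map_add, map_smul, Pi.add_apply, Pi.smul_apply, Fin.zero_eta, Fin.mk_one,
      Fin.reduceFinMk, Matrix.cons_val]
    module

theorem isLinearMap_D₈ : IsLinearMap ℂ (D₈ d) := by
  constructor <;> intros <;> funext r <;>
  · simp only [D₈, map_add, map_smul, Pi.add_apply, Pi.smul_apply]
    module

end Linear

/-- A complex `X → Y → Z` is exact if modulo the image of `X` every element of `Y` lies in a subset
that meets the kernel of `Y → Z` only in `0`. -/
theorem exact_of_transversal {X Y Z : Type*} [AddCommGroup X] [Module ℂ X] [AddCommGroup Y]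
    [Module ℂ Y] [AddCommGroup Z] [Module ℂ Z] {f : X → Y} {g : Y → Z} (hg : IsLinearMap ℂ g)
    (hgf : ∀ x, g (f x) = 0) (T : Set Y) (hT : ∀ y, ∃ x, y - f x ∈ T)
    (hker : ∀ y ∈ T, g y = 0 → y = 0) : Function.Exact f g := by
  intro y
  constructor
  · intro hy
    obtain ⟨x, hx⟩ := hT y
    refine ⟨x, (sub_eq_zero.1 (hker _ hx ?_)).symm⟩
    rw [hg.map_sub, hy, hgf, sub_zero]
  · rintro ⟨x, rfl⟩
    exact hgf x

theorem fin_three_eq (k : Fin 3) : k = 0 ∨ k = 1 ∨ k = 2 := by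
  revert k
  decide

/-! ### Exactness when one of the three endomorphisms is bijective -/

section Exact

variable {M : Type*} [AddCommGroup M] [Module ℂ M] {d : Fin 3 → Module.End ℂ M}

theorem injective_D₁ {k : Fin 3} (hk : Function.Bijective (d k)) : Function.Injective (D₁ d) := by
  intro φ φ' h
  funext u
  apply hk.1
  have := congrFun h k
  fin_cases k <;> simpa [D₁] using this

theorem surjective_D₈ {k : Fin 3} (hk : Function.Bijective (d k)) :
    Function.Surjective (D₈ d) := by
  intro φ
  obtain ⟨x, hx⟩ := hk.2 (φ ())
  refine ⟨Pi.single k x, ?_⟩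
  funext u
  fin_cases k <;> simpa [D₈] using hx

/-- Surjectivity of `d k` normalises `φ k` to zero. The component of `D₂` at h_{kj} is then `d k (d
k (φ j))`, which forces the other two entries to vanish. -/
theorem exact_D₁_D₂ (h : CentralAnticomm d) {k : Fin 3} (hk : Function.Bijective (d k)) :
    Function.Exact (D₁ d) (D₂ d) := by
  have hi : ∀ x, d k x = 0 → x = 0 := fun x hx => hk.1 (hx.trans (map_zero _).symm)
  refine exact_of_transversal (isLinearMap_D₂ d) (D₂_comp_D₁ h) {φ | φ k = 0} (fun φ => ?_)
    fun φ hφ hD => ?_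
  · obtain ⟨x, hx⟩ := hk.2 (φ k)
    refine ⟨fun _ => x, ?_⟩
    obtain rfl | rfl | rfl := fin_three_eq k <;> exact sub_eq_zero.2 hx.symm
  · rw [Set.mem_ofPred_eq] at hφ
    funext r
    obtain rfl | rfl | rfl := fin_three_eq k <;> fin_cases r
    · exact hφ
    · exact hi _ (hi _ (by simpa [D₂, hφ] using congrFun hD .h12))
    · exact hi _ (hi _ (by simpa [D₂, hφ] using congrFun hD .h13))
    · exact hi _ (hi _ (by simpa [D₂, hφ] using congrFun hD .h21))
    · exact hφ
    · exact hi _ (hi _ (by simpa [D₂, hφ] using congrFun hD .h23))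
    · exact hi _ (hi _ (by simpa [D₂, hφ] using congrFun hD .h31))
    · exact hi _ (hi _ (by simpa [D₂, hφ] using congrFun hD .h32))
    · exact hφ

/-- The entry h_{kj} reaches component `j` of `D₇` through the square of `d k` and otherwise affects
only component `k`. Both components with `j ≠ k` can thus be removed, after which `D₈` is `d k (ψ
k)`. -/
theorem exact_D₇_D₈ (h : CentralAnticomm d) {k : Fin 3} (hk : Function.Bijective (d k)) :
    Function.Exact (D₇ d) (D₈ d) := by
  have hi : ∀ x, d k x = 0 → x = 0 := fun x hx => hk.1 (hx.trans (map_zero _).symm)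
  have hs : ∀ y, ∃ x, d k (d k x) = y := fun y => (hk.2.comp hk.2) y
  refine exact_of_transversal (isLinearMap_D₈ d) (D₈_comp_D₇ h) {ψ | ∀ j, j ≠ k → ψ j = 0}
    (fun ψ => ?_) fun ψ (hψ : ∀ j, j ≠ k → ψ j = 0) hD => ?_
  · obtain rfl | rfl | rfl := fin_three_eq k
    · obtain ⟨x, hx⟩ := hs (ψ 1)
      obtain ⟨y, hy⟩ := hs (ψ 2)
      refine ⟨fun
          | .h12 => x | .h13 => y | _ => 0, fun j hj => ?_⟩
      obtain rfl | rfl | rfl := fin_three_eq j <;> simp [D₇, hx, hy] at hj ⊢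
    · obtain ⟨x, hx⟩ := hs (ψ 0)
      obtain ⟨y, hy⟩ := hs (ψ 2)
      refine ⟨fun | .h21 => x | .h23 => y | _ => 0, fun j hj => ?_⟩
      obtain rfl | rfl | rfl := fin_three_eq j <;> simp [D₇, hx, hy] at hj ⊢
    · obtain ⟨x, hx⟩ := hs (ψ 0)
      obtain ⟨y, hy⟩ := hs (ψ 1)
      refine ⟨fun | .h31 => x | .h32 => y | _ => 0, fun j hj => ?_⟩
      obtain rfl | rfl | rfl := fin_three_eq j <;> simp [D₇, hx, hy] at hj ⊢
  · funext j
    by_cases hj : j = k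
    · subst hj
      refine hi _ ?_
      have := congrFun hD ()
      obtain rfl | rfl | rfl := fin_three_eq j <;> simpa [D₈, hψ] using this
    · exact hψ j hj

/-- The two entries h_{kj} are normalised to zero by `D₂`. The other six unknowns then vanish
successively, through five components of `D₃` and the one component of `D₄` of weight 3 in the
direction `k`; the order of elimination matters, since each equation involves unknowns already
killed. -/
theorem exact_D₂_D₃_D₄ (h : CentralAnticomm d) {k : Fin 3} (hk : Function.Bijective (d k)) :
    Function.Exact (D₂ d) (fun w => (D₃ d w, D₄ d w)) := by
  have hi : ∀ x, d k x = 0 → x = 0 := fun x hx => hk.1 (hx.trans (map_zero _).symm)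
  have hs : ∀ y, ∃ x, d k (d k x) = y := fun y => (hk.2.comp hk.2) y
  have hlin : IsLinearMap ℂ (fun w => (D₃ d w, D₄ d w)) :=
    ⟨fun x y => Prod.ext ((isLinearMap_D₃ d).map_add x y) ((isLinearMap_D₄ d).map_add x y),
      fun c x => Prod.ext ((isLinearMap_D₃ d).map_smul c x) ((isLinearMap_D₄ d).map_smul c x)⟩
  have hcomp : ∀ φ, (fun w => (D₃ d w, D₄ d w)) (D₂ d φ) = 0 :=
    fun φ => Prod.ext (D₃_comp_D₂ h φ) (D₄_comp_D₂ h φ)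
  obtain rfl | rfl | rfl := fin_three_eq k
  · refine exact_of_transversal hlin hcomp {ψ | ψ .h12 = 0 ∧ ψ .h13 = 0} (fun ψ => ?_) ?_
    · obtain ⟨x, hx⟩ := hs (ψ .h12)
      obtain ⟨y, hy⟩ := hs (ψ .h13)
      refine ⟨![0, x, y], ?_⟩
      simp [D₂, hx, hy]
    · rintro ψ ⟨z1, z2⟩ hD
      have h3 := congrFun (congrArg Prod.fst hD)
      have h4 := congrFun (congrArg Prod.snd hD)
      have z3 : ψ .h21 = 0 := hi _ (by simpa [D₃, z1] using h3 .v220)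
      have z4 : ψ .h31 = 0 := hi _ (by simpa [D₃, z2] using h3 .v202)
      have z5 : ψ .w1 = 0 := hi _ (by simpa [D₃, z1, z2] using h3 .v211)
      have z6 : ψ .w2 = 0 := hi _ (hi _ (by simpa [D₄, z1, z2, z5] using h4 .w311))
      have z7 : ψ .h23 = 0 := hi _ (by simpa [D₃, z3, z6] using h3 .v121)
      have z8 : ψ .h32 = 0 := hi _ (by simpa [D₃, z4, z5, z6] using h3 .v112)
      funext r
      cases r <;> assumption
  · refine exact_of_transversal hlin hcomp {ψ | ψ .h21 = 0 ∧ ψ .h23 = 0} (fun ψ => ?_) ?_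
    · obtain ⟨x, hx⟩ := hs (ψ .h21)
      obtain ⟨y, hy⟩ := hs (ψ .h23)
      refine ⟨![x, 0, y], ?_⟩
      simp [D₂, hx, hy]
    · rintro ψ ⟨z1, z2⟩ hD
      have h3 := congrFun (congrArg Prod.fst hD)
      have h4 := congrFun (congrArg Prod.snd hD)
      have z3 : ψ .h12 = 0 := hi _ (by simpa [D₃, z1] using h3 .v220)
      have z4 : ψ .h32 = 0 := hi _ (by simpa [D₃, z2] using h3 .v022)
      have z5 : ψ .w2 = 0 := hi _ (by simpa [D₃, z1, z2] using h3 .v121)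
      have z6 : ψ .w1 = 0 := hi _ (hi _ (by simpa [D₄, z1, z2, z5] using h4 .w131))
      have z7 : ψ .h13 = 0 := hi _ (by simpa [D₃, z3, z6] using h3 .v211)
      have z8 : ψ .h31 = 0 := hi _ (by simpa [D₃, z4, z5, z6] using h3 .v112)
      funext r
      cases r <;> assumption
  · refine exact_of_transversal hlin hcomp {ψ | ψ .h31 = 0 ∧ ψ .h32 = 0} (fun ψ => ?_) ?_
    · obtain ⟨x, hx⟩ := hs (ψ .h31)
      obtain ⟨y, hy⟩ := hs (ψ .h32)
      refine ⟨![x, y, 0], ?_⟩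
      simp [D₂, hx, hy]
    · rintro ψ ⟨z1, z2⟩ hD
      have h3 := congrFun (congrArg Prod.fst hD)
      have h4 := congrFun (congrArg Prod.snd hD)
      have z3 : ψ .h13 = 0 := hi _ (by simpa [D₃, z1] using h3 .v202)
      have z4 : ψ .h23 = 0 := hi _ (by simpa [D₃, z2] using h3 .v022)
      -- For this `k` the system is not triangular in `w1`, `w2` separately: `v112` controls their
      -- sum and `w113` their difference.
      have z5 : ψ .w1 = -ψ .w2 := by
        refine eq_neg_of_add_eq_zero_left (hi _ ?_)
        have := congrArg ((-4 : ℂ) • ·) (h3 .v112)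
        simp only [D₃, z1, z2, map_zero, zero_add, zero_sub, Pi.zero_apply, Prod.fst_zero,
          smul_zero] at this
        rw [map_add, ← this]
        module
      have z6 : ψ .w2 = 0 := by
        have := hi _ (hi _ (show d 2 (d 2 (ψ .w1 - ψ .w2)) = 0 by
          simpa [D₄, z1, z2] using h4 .w113))
        have h2 : (2 : ℂ) • ψ .w2 = 0 := by
          rw [z5] at this
          rw [← neg_eq_zero, ← this]
          module
        simpa using h2
      have z7 : ψ .w1 = 0 := by rw [z5, z6, neg_zero]
      have z8 : ψ .h12 = 0 := hi _ (by simpa [D₃, z3, z7] using h3 .v211)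
      have z9 : ψ .h21 = 0 := hi _ (by simpa [D₃, z4, z6] using h3 .v121)
      funext r
      cases r <;> assumption

/-- The six components used for elimination at the previous spot can be prescribed arbitrarily,
because the same triangular system is solvable when `d k` is onto. They are normalised to zero, and
`D₆ + D₅` determines the remaining six: five through `d k`, one entry of `Basis4` through its
square. -/
theorem exact_D₃_D₄_D₆_D₅ (h : CentralAnticomm d) {k : Fin 3} (hk : Function.Bijective (d k)) :
    Function.Exact (fun w => (D₃ d w, D₄ d w))
      (fun u : (Basis4 → M) × (Basis5 → M) => D₆ d u.1 + D₅ d u.2) := by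
  have hi : ∀ x, d k x = 0 → x = 0 := fun x hx => hk.1 (hx.trans (map_zero _).symm)
  have hs : ∀ y, ∃ x, d k x = y := hk.2
  have hlin : IsLinearMap ℂ (fun u : (Basis4 → M) × (Basis5 → M) => D₆ d u.1 + D₅ d u.2) := by
    refine ⟨fun x y => ?_, fun c x => ?_⟩
    · rw [Prod.fst_add, Prod.snd_add, (isLinearMap_D₆ d).map_add, (isLinearMap_D₅ d).map_add]
      abel
    · rw [Prod.smul_fst, Prod.smul_snd, (isLinearMap_D₆ d).map_smul, (isLinearMap_D₅ d).map_smul,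
        smul_add]
  have hcomp := D₆_comp_D₃_add_D₅_comp_D₄ h
  obtain rfl | rfl | rfl := fin_three_eq k
  · refine exact_of_transversal hlin hcomp {u | u.1 .v220 = 0 ∧ u.1 .v202 = 0 ∧ u.1 .v211 = 0 ∧
      u.1 .v121 = 0 ∧ u.1 .v112 = 0 ∧ u.2 .w311 = 0} (fun u => ?_) ?_
    · obtain ⟨x21, hx21⟩ := hs ((-2 : ℂ) • u.1 .v220)
      obtain ⟨x31, hx31⟩ := hs ((-2 : ℂ) • u.1 .v202)
      obtain ⟨y1, hy1⟩ := hs ((-4 : ℂ) • u.1 .v211)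
      -- With `h12 = h13 = 0` the `w311` component of `D₄` is a quarter of `d 0 (d 0 (w1 + 2 w2))`.
      -- Here `y` is half of `d 0 (w1 + 2 w2)`, and the next line solves this for `w2`.
      obtain ⟨y, hy⟩ := hs ((2 : ℂ) • u.2 .w311)
      obtain ⟨y2, hy2⟩ := hs (y - (1 / 2 : ℂ) • d 0 y1)
      obtain ⟨x23, hx23⟩ := hs ((-4 : ℂ) • u.1 .v121 - d 2 x21 - d 1 y2)
      obtain ⟨x32, hx32⟩ := hs ((4 : ℂ) • u.1 .v112 - d 1 x31 + d 2 y1 + d 2 y2)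
      refine ⟨fun
          | .h12 => 0 | .h13 => 0 | .h21 => x21 | .h31 => x31 | .w1 => y1 | .w2 => y2
          | .h23 => x23 | .h32 => x32, ?_⟩
      simp only [Set.mem_ofPred_eq, Prod.fst_sub, Prod.snd_sub, Pi.sub_apply, D₃, D₄, map_zero,
        map_add, map_smul, map_sub, hx21, hx31, hy1, hy, hy2, hx23, hx32]
      refine ⟨?_, ?_, ?_, ?_, ?_, ?_⟩ <;> module
    · rintro u ⟨z1, z2, z3, z4, z5, z6⟩ hD
      have e := congrFun hD
      have t1 : u.2 .w212 = 0 := hi _ (by simpa [D₆, D₅, z1, z2, z3, z4, z5, z6] using e .h23)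
      have t2 : u.2 .w221 = 0 := hi _ (by simpa [D₆, D₅, z1, z2, z3, z4, z5, z6] using e .h32)
      have t3 : u.2 .w113 = 0 := hi _ (by simpa [D₆, D₅, z1, z2, z3, z4, z5, z6, t1] using e .h21)
      have t4 : u.2 .w131 = 0 := hi _ (by simpa [D₆, D₅, z1, z2, z3, z4, z5, z6, t2] using e .h31)
      have t5 : u.1 .v022 = 0 :=
        hi _ (hi _ (by simpa [D₆, D₅, z1, z2, z3, z4, z5, z6, t1, t2] using e .w2))
      have t6 : u.2 .w122 = 0 :=
        hi _ (by simpa [D₆, D₅, z1, z2, z3, z4, z5, z6, t1, t2, t5] using e .w1)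
      refine Prod.ext ?_ ?_ <;> funext r <;> cases r <;> assumption
  · refine exact_of_transversal hlin hcomp {u | u.1 .v220 = 0 ∧ u.1 .v022 = 0 ∧ u.1 .v211 = 0 ∧
      u.1 .v121 = 0 ∧ u.1 .v112 = 0 ∧ u.2 .w131 = 0} (fun u => ?_) ?_
    · obtain ⟨x12, hx12⟩ := hs ((-2 : ℂ) • u.1 .v220)
      obtain ⟨x32, hx32⟩ := hs ((-2 : ℂ) • u.1 .v022)
      obtain ⟨y2, hy2⟩ := hs ((-4 : ℂ) • u.1 .v121)
      -- Here `y` is half of `d 1 (2 w1 + w2)`; the sign comes from the leading minus in the `w131`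
      -- component of `D₄`.
      obtain ⟨y, hy⟩ := hs ((-2 : ℂ) • u.2 .w131)
      obtain ⟨y1, hy1⟩ := hs (y - (1 / 2 : ℂ) • d 1 y2)
      obtain ⟨x13, hx13⟩ := hs ((-4 : ℂ) • u.1 .v211 - d 2 x12 - d 0 y1)
      obtain ⟨x31, hx31⟩ := hs ((4 : ℂ) • u.1 .v112 - d 0 x32 + d 2 y1 + d 2 y2)
      refine ⟨fun
          | .h12 => x12 | .h13 => x13 | .h21 => 0 | .h31 => x31 | .w1 => y1 | .w2 => y2
          | .h23 => 0 | .h32 => x32, ?_⟩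
      simp only [Set.mem_ofPred_eq, Prod.fst_sub, Prod.snd_sub, Pi.sub_apply, D₃, D₄, map_zero,
        map_add, map_smul, map_sub, hx12, hx32, hy2, hy, hy1, hx13, hx31]
      refine ⟨?_, ?_, ?_, ?_, ?_, ?_⟩ <;> module
    · rintro u ⟨z1, z2, z3, z4, z5, z6⟩ hD
      have e := congrFun hD
      have t1 : u.2 .w122 = 0 := hi _ (by simpa [D₆, D₅, z1, z2, z3, z4, z5, z6] using e .h13)
      have t2 : u.2 .w221 = 0 := hi _ (by simpa [D₆, D₅, z1, z2, z3, z4, z5, z6] using e .h31)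
      have t3 : u.2 .w113 = 0 := hi _ (by simpa [D₆, D₅, z1, z2, z3, z4, z5, z6, t1] using e .h12)
      have t4 : u.2 .w311 = 0 := hi _ (by simpa [D₆, D₅, z1, z2, z3, z4, z5, z6, t2] using e .h32)
      have t5 : u.1 .v202 = 0 :=
        hi _ (hi _ (by simpa [D₆, D₅, z1, z2, z3, z4, z5, z6, t1, t2] using e .w1))
      have t6 : u.2 .w212 = 0 :=
        hi _ (by simpa [D₆, D₅, z1, z2, z3, z4, z5, z6, t1, t2, t5] using e .w2)
      refine Prod.ext ?_ ?_ <;> funext r <;> cases r <;> assumption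
  · refine exact_of_transversal hlin hcomp {u | u.1 .v202 = 0 ∧ u.1 .v022 = 0 ∧ u.1 .v211 = 0 ∧
      u.1 .v121 = 0 ∧ u.1 .v112 = 0 ∧ u.2 .w113 = 0} (fun u => ?_) ?_
    · obtain ⟨x13, hx13⟩ := hs ((-2 : ℂ) • u.1 .v202)
      obtain ⟨x23, hx23⟩ := hs ((-2 : ℂ) • u.1 .v022)
      -- The sum `s` and the difference `t` of `w1` and `w2` are prescribed by `v112` and `w113`;
      -- halving recovers the two entries.
      obtain ⟨s, hy⟩ := hs ((-4 : ℂ) • u.1 .v112)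
      obtain ⟨t', ht'⟩ := hs ((4 : ℂ) • u.2 .w113)
      obtain ⟨t, ht⟩ := hs t'
      obtain ⟨x12, hx12⟩ := hs ((-4 : ℂ) • u.1 .v211 - d 1 x13 - d 0 ((1 / 2 : ℂ) • (s + t)))
      obtain ⟨x21, hx21⟩ := hs ((-4 : ℂ) • u.1 .v121 - d 0 x23 - d 1 ((1 / 2 : ℂ) • (s - t)))
      refine ⟨fun
          | .h12 => x12 | .h13 => x13 | .h21 => x21 | .h31 => 0
          | .w1 => (1 / 2 : ℂ) • (s + t) | .w2 => (1 / 2 : ℂ) • (s - t)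
          | .h23 => x23 | .h32 => 0, ?_⟩
      simp only [Set.mem_ofPred_eq, Prod.fst_sub, Prod.snd_sub, Pi.sub_apply, D₃, D₄, map_zero,
        map_add, map_smul, map_sub, hx13, hx23, hy, ht', ht, hx12, hx21]
      refine ⟨?_, ?_, ?_, ?_, ?_, ?_⟩ <;> module
    · rintro u ⟨z1, z2, z3, z4, z5, z6⟩ hD
      have e := congrFun hD
      have t1 : u.2 .w122 = 0 := hi _ (by simpa [D₆, D₅, z1, z2, z3, z4, z5, z6] using e .h12)
      have t2 : u.2 .w212 = 0 := hi _ (by simpa [D₆, D₅, z1, z2, z3, z4, z5, z6] using e .h21)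
      have t3 : u.2 .w131 = 0 := hi _ (by simpa [D₆, D₅, z1, z2, z3, z4, z5, z6, t1] using e .h13)
      have t4 : u.2 .w311 = 0 := hi _ (by simpa [D₆, D₅, z1, z2, z3, z4, z5, z6, t2] using e .h23)
      -- The `v220` terms of the `w1` and `w2` components are opposite, so the sum of the two
      -- equations isolates `d 2` of the `w221` entry, with factor -1/12.
      have t5 : u.2 .w221 = 0 := hi _ (by
        have := congrArg ((-12 : ℂ) • ·) (congrArg₂ (· + ·) (e .w1) (e .w2))
        simp only [D₆, D₅, z1, z2, z3, z4, z5, t1, t2, Pi.add_apply, Pi.zero_apply, map_zero,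
          smul_zero, add_zero] at this
        rw [← this]
        module)
      have t6 : u.1 .v220 = 0 :=
        hi _ (hi _ (by simpa [D₆, D₅, z1, z2, z3, z4, z5, z6, t1, t2, t5] using e .w1))
      refine Prod.ext ?_ ?_ <;> funext r <;> cases r <;> assumption

/-- One entry of `Basis4` and five of `Basis5`, those not normalised at the previous spot, suffice
to remove all components except the two h_{kj}. On these `D₇` acts by the square of `d k` in
component `j`. -/
theorem exact_D₆_D₅_D₇ (h : CentralAnticomm d) {k : Fin 3} (hk : Function.Bijective (d k)) :
    Function.Exact (fun u : (Basis4 → M) × (Basis5 → M) => D₆ d u.1 + D₅ d u.2) (D₇ d) := by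
  have hi : ∀ x, d k x = 0 → x = 0 := fun x hx => hk.1 (hx.trans (map_zero _).symm)
  have hs : ∀ y, ∃ x, d k x = y := hk.2
  have hcomp : ∀ u : (Basis4 → M) × (Basis5 → M), D₇ d (D₆ d u.1 + D₅ d u.2) = 0 := fun u => by
    rw [(isLinearMap_D₇ d).map_add, D₇_comp_D₆ h, D₇_comp_D₅ h, add_zero]
  obtain rfl | rfl | rfl := fin_three_eq k
  · refine exact_of_transversal (isLinearMap_D₇ d) hcomp {φ | φ .h21 = 0 ∧ φ .h31 = 0 ∧
      φ .h23 = 0 ∧ φ .h32 = 0 ∧ φ .w1 = 0 ∧ φ .w2 = 0} (fun φ => ?_) ?_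
    -- The factor 24 clears the normalisation of `D₅`. The coefficient 1/2 of `d 0 v'` below is 1/48
    -- against 1/24, and `v'` stands for `d 0 v`.
    · obtain ⟨c, hc⟩ := hs ((24 : ℂ) • φ .h23)
      obtain ⟨e, he⟩ := hs ((24 : ℂ) • φ .h32)
      obtain ⟨a, ha⟩ := hs ((-24 : ℂ) • φ .h21 + d 2 c)
      obtain ⟨b, hb⟩ := hs ((-24 : ℂ) • φ .h31 + d 1 e)
      obtain ⟨v', hv'⟩ := hs ((24 : ℂ) • φ .w2 - d 1 c + d 2 e)
      obtain ⟨v, hv⟩ := hs v'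
      obtain ⟨f, hf⟩ := hs ((24 : ℂ) • φ .w1 + d 2 e - (1 / 2 : ℂ) • d 0 v')
      refine ⟨(fun | .v022 => v | _ => 0,
        fun
          | .w311 => 0 | .w131 => b | .w113 => a
          | .w221 => e | .w212 => c | .w122 => f), ?_⟩
      simp only [Set.mem_ofPred_eq, Pi.sub_apply, Pi.add_apply, D₅, D₆, map_zero, hc, he, ha, hb,
          hv', hv, hf]
      refine ⟨?_, ?_, ?_, ?_, ?_, ?_⟩ <;> module
    · rintro φ ⟨z1, z2, z3, z4, z5, z6⟩ hD
      have e := congrFun hD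
      have t1 : φ .h12 = 0 := hi _ (hi _ (by simpa [D₇, z1, z2, z3, z4, z5, z6] using e 1))
      have t2 : φ .h13 = 0 := hi _ (hi _ (by simpa [D₇, z1, z2, z3, z4, z5, z6] using e 2))
      funext r
      cases r <;> assumption
  · refine exact_of_transversal (isLinearMap_D₇ d) hcomp {φ | φ .h12 = 0 ∧ φ .h32 = 0 ∧
      φ .h13 = 0 ∧ φ .h31 = 0 ∧ φ .w1 = 0 ∧ φ .w2 = 0} (fun φ => ?_) ?_
    · obtain ⟨f, hf⟩ := hs ((24 : ℂ) • φ .h13)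
      obtain ⟨e, he⟩ := hs ((24 : ℂ) • φ .h31)
      obtain ⟨a, ha⟩ := hs ((-24 : ℂ) • φ .h12 + d 2 f)
      obtain ⟨b, hb⟩ := hs ((-24 : ℂ) • φ .h32 + d 0 e)
      obtain ⟨v', hv'⟩ := hs ((-24 : ℂ) • φ .w1 + d 0 f - d 2 e)
      obtain ⟨v, hv⟩ := hs v'
      obtain ⟨c, hc⟩ := hs ((24 : ℂ) • φ .w2 + d 2 e + (1 / 2 : ℂ) • d 1 v')
      refine ⟨(fun | .v202 => v | _ => 0,
        fun
          | .w311 => b | .w131 => 0 | .w113 => a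
          | .w221 => e | .w212 => c | .w122 => f), ?_⟩
      simp only [Set.mem_ofPred_eq, Pi.sub_apply, Pi.add_apply, D₅, D₆, map_zero, hf, he, ha, hb,
          hv', hv, hc]
      refine ⟨?_, ?_, ?_, ?_, ?_, ?_⟩ <;> module
    · rintro φ ⟨z1, z2, z3, z4, z5, z6⟩ hD
      have e := congrFun hD
      have t1 : φ .h21 = 0 := hi _ (hi _ (by simpa [D₇, z1, z2, z3, z4, z5, z6] using e 0))
      have t2 : φ .h23 = 0 := hi _ (hi _ (by simpa [D₇, z1, z2, z3, z4, z5, z6] using e 2))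
      funext r
      cases r <;> assumption
  · refine exact_of_transversal (isLinearMap_D₇ d) hcomp {φ | φ .h12 = 0 ∧ φ .h21 = 0 ∧
      φ .h13 = 0 ∧ φ .h23 = 0 ∧ φ .w1 = 0 ∧ φ .w2 = 0} (fun φ => ?_) ?_
    · obtain ⟨f, hf⟩ := hs ((24 : ℂ) • φ .h12)
      obtain ⟨c, hc⟩ := hs ((24 : ℂ) • φ .h21)
      obtain ⟨a, ha⟩ := hs ((-24 : ℂ) • φ .h13 + d 1 f)
      obtain ⟨b, hb⟩ := hs ((-24 : ℂ) • φ .h23 + d 0 c)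
      -- As `v220` enters the `w1` and `w2` components with opposite signs, their sum yields `e` and
      -- their difference `v`.
      obtain ⟨e, he⟩ := hs ((-12 : ℂ) • (φ .w1 + φ .w2) + (1 / 2 : ℂ) • (d 0 f + d 1 c))
      obtain ⟨v', hv'⟩ := hs ((24 : ℂ) • (φ .w1 - φ .w2) - d 0 f + d 1 c)
      obtain ⟨v, hv⟩ := hs v'
      refine ⟨(fun | .v220 => v | _ => 0,
        fun
          | .w311 => b | .w131 => a | .w113 => 0
          | .w221 => e | .w212 => c | .w122 => f), ?_⟩
      simp only [Set.mem_ofPred_eq, Pi.sub_apply, Pi.add_apply, D₅, D₆, map_zero, hf, hc, ha, hb,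
          he, hv', hv]
      refine ⟨?_, ?_, ?_, ?_, ?_, ?_⟩ <;> module
    · rintro φ ⟨z1, z2, z3, z4, z5, z6⟩ hD
      have e := congrFun hD
      have t1 : φ .h31 = 0 := hi _ (hi _ (by simpa [D₇, z1, z2, z3, z4, z5, z6] using e 0))
      have t2 : φ .h32 = 0 := hi _ (hi _ (by simpa [D₇, z1, z2, z3, z4, z5, z6] using e 1))
      funext r
      cases r <;> assumption

end Exact
end ThreeDirac

namespace ThreeDirac

/-! ### Commutation relations of the Dirac operators and of their symbols -/

section Commutation

variable {n : ℕ}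

/-- On invariant functions the field `ξ_{X_{kμ}}` acts as the coordinate derivative `∂_{kμ}`. -/
theorem IsInvariant.lieDeriv_xiOne {W : Type*} [NormedAddCommGroup W] [NormedSpace ℝ W]
    {f : Chart n → W} (hf : IsInvariant f) (k : Fin 3) (μ : Fin n) :
    lieDeriv (ThreeDirac.xiOne k μ) f = fun x => fderiv ℝ f x (rowVec k μ, 0) := by
  funext x
  have hsplit : ThreeDirac.xiOne k μ x = (rowVec k μ, 0) +
      (-(1 / (2 * √((n : ℝ) + 2)))) • ∑ i, x.1 i μ • xiTwo k i x := by
    ext <;> simp [ThreeDirac.xiOne, xiTwo, Prod.fst_sum, Prod.snd_sum]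
  have h0 : ∀ i, fderiv ℝ f x (xiTwo k i x) = 0 := fun i => congrFun (hf.2 k i) x
  simp only [lieDeriv]
  rw [hsplit, map_add, map_smul, map_sum]
  simp [h0]

/-- The brackets of the horizontal fields lie in 𝔤₋₂, which annihilates invariant functions.
Concretely, both sides are mixed second coordinate derivatives, so symmetry of the second derivative
applies. -/
theorem IsInvariant.lieDeriv_xiOne_comm {W : Type*} [NormedAddCommGroup W] [NormedSpace ℝ W]
    {f : Chart n → W} (hf : IsInvariant f) (k l : Fin 3) (μ ν : Fin n) :
    lieDeriv (ThreeDirac.xiOne k μ) (lieDeriv (ThreeDirac.xiOne l ν) f) =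
      lieDeriv (ThreeDirac.xiOne l ν) (lieDeriv (ThreeDirac.xiOne k μ) f) := by
  rw [(hf.xiOne l ν).lieDeriv_xiOne, (hf.xiOne k μ).lieDeriv_xiOne, hf.lieDeriv_xiOne,
    hf.lieDeriv_xiOne]
  funext x
  have hsm : ContDiff ℝ ∞ (fderiv ℝ f) := hf.1.fderiv_right (by simp)
  have hd : DifferentiableAt ℝ (fderiv ℝ f) x := (hsm.differentiable (by simp)) x
  have e1 : ∀ u v : Chart n, fderiv ℝ (fun y => fderiv ℝ f y u) x v
      = fderiv ℝ (fderiv ℝ f) x v u := by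
    intro u v
    rw [fderiv_clm_apply hd (differentiableAt_const u)]
    simp
  have hsymm : IsSymmSndFDerivAt ℝ f x :=
    hf.1.contDiffAt.isSymmSndFDerivAt (by
      rw [minSmoothness_of_isRCLikeNormedField]; exact WithTop.coe_le_coe.2 (le_top : (2 : ℕ∞) ≤ ⊤))
  rw [e1, e1, hsymm.eq]

variable {S : Type*} [NormedAddCommGroup S] [NormedSpace ℂ S]

/-- The derivation `ξ_{X_{kμ}}` of invariant sections. -/
noncomputable def xiDeriv (n : ℕ) (S : Type*) [NormedAddCommGroup S] [NormedSpace ℂ S] (k : Fin 3)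
    (μ : Fin n) : Module.End ℂ (invSections n S) where
  toFun f := ⟨lieDeriv (xiOne k μ) f.1, IsInvariant.xiOne f.2 k μ⟩
  map_add' f g := by
    apply Subtype.ext
    funext x
    simp [lieDeriv, fderiv_add (IsInvariant.diff f.2 x) (IsInvariant.diff g.2 x)]
  map_smul' c f := by
    apply Subtype.ext
    funext x
    simp [lieDeriv, fderiv_const_smul (IsInvariant.diff f.2 x) c]

theorem xiDeriv_commute (k l : Fin 3) (μ ν : Fin n) :
    Commute (xiDeriv n S k μ) (xiDeriv n S l ν) :=
  LinearMap.ext fun f => Subtype.ext (IsInvariant.lieDeriv_xiOne_comm f.2 k l μ ν)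

theorem cliffordGen_anticomm (α β : Fin n) :
    cliffordGen α * cliffordGen β + cliffordGen β * cliffordGen α =
      algebraMap ℝ (CliffordAlgebra (cliffordForm n)) (if α = β then -2 else 0) := by
  rw [cliffordGen, cliffordGen, CliffordAlgebra.ι_mul_ι_add_swap]
  congr 1
  have hQ : ∀ v : Fin n → ℝ, cliffordForm n v = -∑ γ, v γ * v γ := fun v => by
    simp [cliffordForm, QuadraticMap.weightedSumSquares_apply]
  simp only [QuadraticMap.polar, hQ, Pi.add_apply, add_mul, mul_add, Finset.sum_add_distrib]
  split_ifs with h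
  · subst h
    simp [Pi.single_apply]
    norm_num
  · simp [Pi.single_apply, h, Ne.symm h]

/-- The anticommutator of two linear combinations of the Clifford generators with coefficients that
commute with them and with each other. -/
theorem sum_mul_sum_anticomm {R : Type*} [Ring R] [Algebra ℝ R] (ε p q : Fin n → R)
    (hε : ∀ α β, ε α * ε β + ε β * ε α = algebraMap ℝ R (if α = β then -2 else 0))
    (hεp : ∀ α β, Commute (ε α) (p β)) (hεq : ∀ α β, Commute (ε α) (q β))
    (hpq : ∀ α β, Commute (p α) (q β)) :
    (∑ α, ε α * p α) * (∑ α, ε α * q α) + (∑ α, ε α * q α) * (∑ α, ε α * p α) =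
      ∑ α, algebraMap ℝ R (-2) * (p α * q α) := by
  -- Exchanging the order of summation in the second product pairs the terms so that each pair (α,
  -- β) contributes {ε_α, ε_β} p_α q_β, which vanishes off the diagonal.
  rw [Finset.sum_mul_sum, Finset.sum_mul_sum, Finset.sum_comm (f := fun i j => ε i * q i * _),
    ← Finset.sum_add_distrib]
  refine Finset.sum_congr rfl fun α _ => ?_
  rw [← Finset.sum_add_distrib]
  have : ∀ β, ε α * p α * (ε β * q β) + ε β * q β * (ε α * p α) =
      if α = β then algebraMap ℝ R (-2) * (p α * q α) else 0 := by
    intro β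
    have h1 : ε α * p α * (ε β * q β) = ε α * ε β * (p α * q β) := by
      rw [mul_assoc, ← mul_assoc (p α), ← (hεp β α).eq]
      simp only [mul_assoc]
    have h2 : ε β * q β * (ε α * p α) = ε β * ε α * (p α * q β) := by
      rw [mul_assoc, ← mul_assoc (q β), ← (hεq α β).eq, mul_assoc, ← (hpq α β).eq, mul_assoc]
    rw [h1, h2, ← add_mul, hε]
    split_ifs with h
    · rw [h]
    · simp
  simp [this]

variable (ρ : CliffordAlgebra (cliffordForm n) →ₐ[ℝ] Module.End ℂ S)

/-- The Clifford element of the components of `dg_x` along the fields `ξ_{X_{iα}}`. -/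
noncomputable def symbolEnd (x : Chart n) (g : invFunctions n) (i : Fin 3) : Module.End ℂ S :=
  ∑ α, ρ (cliffordGen α) * algebraMap ℝ (Module.End ℂ S) (lieDeriv (xiOne i α) g.1 x)

theorem symbolEnd_anticomm (x : Chart n) (g : invFunctions n) (i j : Fin 3) :
    symbolEnd ρ x g i * symbolEnd ρ x g j + symbolEnd ρ x g j * symbolEnd ρ x g i =
      algebraMap ℝ (Module.End ℂ S)
        (∑ α, -2 * (lieDeriv (xiOne i α) g.1 x * lieDeriv (xiOne j α) g.1 x)) := by
  rw [symbolEnd, symbolEnd, sum_mul_sum_anticomm (fun α => ρ (cliffordGen α))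
    (fun α => algebraMap ℝ (Module.End ℂ S) (lieDeriv (xiOne i α) g.1 x))
    (fun α => algebraMap ℝ (Module.End ℂ S) (lieDeriv (xiOne j α) g.1 x))]
  · simp only [map_sum, map_mul]
  · intro α β
    rw [← map_mul, ← map_mul, ← map_add, cliffordGen_anticomm, AlgHom.commutes]
  all_goals exact fun _ _ => Algebra.commute_algebraMap_right _ _

theorem centralAnticomm_symbolEnd (x : Chart n) (g : invFunctions n) :
    CentralAnticomm (symbolEnd ρ x g) := by
  intro i j k
  rw [symbolEnd_anticomm]
  exact Algebra.commutes _ _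

/-- The square of the Clifford element is minus the squared norm of the row (ξ_{kα} g)_α. This is a
nonzero real scalar, so the element is its own inverse up to a scalar. -/
theorem symbolEnd_bijective {x : Chart n} {g : invFunctions n} {k : Fin 3} {μ : Fin n}
    (h : lieDeriv (xiOne k μ) g.1 x ≠ 0) : Function.Bijective (symbolEnd ρ x g k) := by
  have hpos : 0 < ∑ α, lieDeriv (xiOne k α) g.1 x ^ 2 :=
    Finset.sum_pos' (fun _ _ => sq_nonneg _) ⟨μ, Finset.mem_univ _, by positivity⟩
  set c := ∑ α, lieDeriv (xiOne k α) g.1 x ^ 2 with hc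
  have hsq : symbolEnd ρ x g k * symbolEnd ρ x g k = algebraMap ℝ (Module.End ℂ S) (-c) := by
    have h2 := symbolEnd_anticomm ρ x g k k
    have h3 : symbolEnd ρ x g k * symbolEnd ρ x g k =
        (2⁻¹ : ℝ) • (symbolEnd ρ x g k * symbolEnd ρ x g k +
          symbolEnd ρ x g k * symbolEnd ρ x g k) := by module
    rw [h3, h2, Algebra.smul_def, ← map_mul, ← Finset.mul_sum, hc]
    congr 1
    simp only [pow_two]
    ring
  have hev : ∀ v, symbolEnd ρ x g k (symbolEnd ρ x g k v) = (-c) • v := fun v =>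
    LinearMap.congr_fun hsq v
  refine ⟨(injective_iff_map_eq_zero _).2 fun v hv => ?_, fun v =>
    ⟨(-c)⁻¹ • symbolEnd ρ x g k v, ?_⟩⟩
  · have := hev v
    rw [hv, map_zero] at this
    exact (smul_eq_zero.1 this.symm).resolve_left (by linarith)
  · rw [LinearMap.map_smul_of_tower, hev, smul_smul, inv_mul_cancel₀ (by linarith), one_smul]

variable [FiniteDimensional ℂ S]

/-- The pointwise action of endomorphisms of the fibre on invariant sections. -/
noncomputable def fibreEnd (n : ℕ) (A : Module.End ℂ S) : Module.End ℂ (invSections n S) where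
  toFun f := ⟨fun x => A (f.1 x),
    IsInvariant.clm f.2 ((LinearMap.toContinuousLinearMap A).restrictScalars ℝ)⟩
  map_add' _ _ := Subtype.ext <| funext fun _ => map_add A _ _
  map_smul' _ _ := Subtype.ext <| funext fun _ => map_smul A _ _

theorem fibreEnd_commute_xiDeriv (A : Module.End ℂ S) (k : Fin 3) (μ : Fin n) :
    Commute (fibreEnd n A) (xiDeriv n S k μ) := by
  refine LinearMap.ext fun f => Subtype.ext (funext fun x => ?_)
  change A (fderiv ℝ f.1 x (xiOne k μ x)) = fderiv ℝ (fun y => A (f.1 y)) x (xiOne k μ x)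
  have : fderiv ℝ (fun y => A (f.1 y)) x =
      ((LinearMap.toContinuousLinearMap A).restrictScalars ℝ).comp (fderiv ℝ f.1 x) :=
    (((LinearMap.toContinuousLinearMap A).restrictScalars ℝ).hasFDerivAt.comp x
      (IsInvariant.diff f.2 x).hasFDerivAt).fderiv
  rw [this]
  rfl

theorem dirac_eq_sum (i : Fin 3) :
    dirac ρ i = ∑ α, fibreEnd n (ρ (cliffordGen α)) * xiDeriv n S i α := by
  refine LinearMap.ext fun f => Subtype.ext (funext fun x => ?_)
  rw [LinearMap.sum_apply, Submodule.coe_sum, Finset.sum_apply]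
  rfl

theorem fibreEnd_anticomm (α β : Fin n) :
    fibreEnd n (ρ (cliffordGen α)) * fibreEnd n (ρ (cliffordGen β)) +
      fibreEnd n (ρ (cliffordGen β)) * fibreEnd n (ρ (cliffordGen α)) =
      algebraMap ℝ (Module.End ℂ (invSections n S)) (if α = β then -2 else 0) := by
  refine LinearMap.ext fun f => Subtype.ext (funext fun x => ?_)
  have := congrArg ρ (cliffordGen_anticomm α β)
  rw [map_add, map_mul, map_mul, AlgHom.commutes] at this
  exact LinearMap.congr_fun this (f.1 x)

/-- The anticommutator is -2 ∑_α ξ_{iα} ξ_{jα}: no Clifford generator survives in it. It commutes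
with Clifford multiplication, which is constant on the chart, and with all the ξ, hence with every
∂_k. -/
theorem centralAnticomm_dirac : CentralAnticomm (dirac ρ) := by
  intro i j k
  rw [dirac_eq_sum, dirac_eq_sum, dirac_eq_sum,
    sum_mul_sum_anticomm (fun α => fibreEnd n (ρ (cliffordGen α))) _ _ (fibreEnd_anticomm ρ) (fun _ _ => fibreEnd_commute_xiDeriv _ _ _)
      (fun _ _ => fibreEnd_commute_xiDeriv _ _ _) (fun _ _ => xiDeriv_commute _ _ _ _)]
  refine Commute.sum_left _ _ _ fun α _ => Commute.sum_right _ _ _ fun β _ => ?_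
  refine Commute.mul_left (Algebra.commutes _ _) (.mul_left ?_ ?_) <;>
  exact (fibreEnd_commute_xiDeriv _ _ _).symm.mul_right (xiDeriv_commute _ _ _ _)

theorem exists_xiOne_ne_zero {x : Chart n} {L : Chart n →L[ℝ] ℝ}
    (h : ∃ X ∈ horizontal x, L X ≠ 0) : ∃ k μ, L (xiOne k μ x) ≠ 0 := by
  by_contra! hc
  obtain ⟨X, hX, hne⟩ := h
  refine hne ?_
  have : horizontal x ≤ LinearMap.ker (L : Chart n →ₗ[ℝ] ℝ) := by
    refine Submodule.span_le.2 ?_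
    rintro v ⟨k, μ, rfl⟩
    exact hc k μ
  exact this hX

end Commutation
end ThreeDirac

namespace ThreeDirac

/-! ### The Leibniz rule and the principal symbols -/

section Leibniz

variable {n : ℕ} {S : Type*} [NormedAddCommGroup S] [NormedSpace ℂ S]

theorem mulSection_pow_succ_apply {x : Chart n} {g : invFunctions n} (hg : g.1 x = 0) (m : ℕ) (s : invSections n S) :
    (mulSection (g ^ (m + 1)) s).1 x = 0 := by
  change g.1 x ^ (m + 1) • s.1 x = 0
  rw [hg, zero_pow m.succ_ne_zero, zero_smul]

theorem mulSection_pow_zero_apply {x : Chart n} {g : invFunctions n} (s : invSections n S) : (mulSection (g ^ 0) s).1 x = s.1 x := by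
  change g.1 x ^ 0 • s.1 x = s.1 x
  rw [pow_zero, one_smul]

theorem inv_factorial_two_smul (v : S) : ((Nat.factorial 2 : ℝ)⁻¹) • v = (1 / 2 : ℂ) • v := by
  rw [← Complex.coe_smul]
  norm_num

variable (ρ : CliffordAlgebra (cliffordForm n) →ₐ[ℝ] Module.End ℂ S)

theorem symbolEnd_apply (x : Chart n) (g : invFunctions n) (i : Fin 3) (v : S) :
    symbolEnd ρ x g i v = ∑ α, lieDeriv (xiOne i α) g.1 x • ρ (cliffordGen α) v := by
  rw [symbolEnd, LinearMap.sum_apply]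
  refine Finset.sum_congr rfl fun α _ => ?_
  rw [Module.End.mul_apply, Module.algebraMap_end_apply, LinearMap.map_smul_of_tower]

theorem symbolEnd_pow_succ (x : Chart n) (g : invFunctions n) (m : ℕ) (i : Fin 3) :
    symbolEnd ρ x (g ^ (m + 1)) i = ((m + 1 : ℝ) * g.1 x ^ m) • symbolEnd ρ x g i := by
  have hg : DifferentiableAt ℝ g.1 x := IsInvariant.diff g.2 x
  refine LinearMap.ext fun v => ?_
  rw [LinearMap.smul_apply, symbolEnd_apply, symbolEnd_apply, Finset.smul_sum]
  refine Finset.sum_congr rfl fun α _ => ?_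
  rw [smul_smul]
  congr 1
  change fderiv ℝ (fun y => g.1 y ^ (m + 1)) x (xiOne i α x) = _
  rw [fderiv_fun_pow _ hg]
  simp [lieDeriv]

variable [FiniteDimensional ℂ S]

/-- The commutator of ∂_i with multiplication by `g` is of order zero: pointwise Clifford
multiplication by the i-th row of dg. -/
theorem dirac_mulSection_apply (g : invFunctions n) (s : invSections n S) (i : Fin 3)
    (x : Chart n) : (dirac ρ i (mulSection g s)).1 x =
      g.1 x • (dirac ρ i s).1 x + symbolEnd ρ x g i (s.1 x) := by
  have hg : DifferentiableAt ℝ g.1 x := IsInvariant.diff g.2 x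
  have hs : DifferentiableAt ℝ s.1 x := IsInvariant.diff s.2 x
  change ∑ α : Fin n, ρ (cliffordGen α) (fderiv ℝ (fun y => g.1 y • s.1 y) x (xiOne i α x)) =
    g.1 x • ∑ α : Fin n, ρ (cliffordGen α) (fderiv ℝ s.1 x (xiOne i α x)) + _
  rw [symbolEnd_apply, fderiv_fun_smul hg hs, Finset.smul_sum, ← Finset.sum_add_distrib]
  refine Finset.sum_congr rfl fun α _ => ?_
  simp [lieDeriv, LinearMap.map_smul_of_tower]

/-- Differentiating `g ^ (m + 1) s` leaves a factor `g ^ m`. -/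
theorem exists_dirac_mulSection_pow_succ (g : invFunctions n) (m : ℕ) (s : invSections n S)
    (i : Fin 3) : ∃ t : invSections n S,
      dirac ρ i (mulSection (g ^ (m + 1)) s) = mulSection (g ^ m) t ∧
      ∀ x, g.1 x = 0 → t.1 x = (m + 1 : ℂ) • symbolEnd ρ x g i (s.1 x) := by
  -- The section `t` is g ∂_i s + (m + 1) [∂_i, g] s. Writing the Clifford term as a commutator of
  -- operators on sections makes its smoothness and invariance automatic.
  have hval : ∀ x, (mulSection g (dirac ρ i s) + (m + 1 : ℂ) •
      (dirac ρ i (mulSection g s) - mulSection g (dirac ρ i s))).1 x =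
      g.1 x • (dirac ρ i s).1 x + (m + 1 : ℂ) • symbolEnd ρ x g i (s.1 x) := fun x => by
    change g.1 x • (dirac ρ i s).1 x + (m + 1 : ℂ) •
      ((dirac ρ i (mulSection g s)).1 x - g.1 x • (dirac ρ i s).1 x) = _
    rw [dirac_mulSection_apply, add_sub_cancel_left]
  refine ⟨_, Subtype.ext (funext fun x => ?_), fun x hx => (hval x).trans ?_⟩
  · rw [dirac_mulSection_apply, symbolEnd_pow_succ]
    change g.1 x ^ (m + 1) • _ + _ = g.1 x ^ m • (_ : S)
    rw [hval, LinearMap.smul_apply, smul_add, smul_smul, pow_succ, mul_comm (m + 1 : ℝ),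
      mul_smul (g.1 x ^ m) (m + 1 : ℝ)]
    congr 2
    rw [← Complex.coe_smul]
    push_cast
    rfl
  · rw [hx, zero_smul, zero_add]

variable {ρ} {x : Chart n} {g : invFunctions n}

theorem dirac_mulSection_pow_one (hg : g.1 x = 0) (i : Fin 3) (v : S) :
    (dirac ρ i (mulSection (g ^ 1) (constSection n v))).1 x = symbolEnd ρ x g i v := by
  obtain ⟨t, ht, htx⟩ := exists_dirac_mulSection_pow_succ ρ g 0 (constSection n v) i
  rw [ht, mulSection_pow_zero_apply, htx x hg]
  simp [constSection]

theorem dirac_mulSection_pow_two (hg : g.1 x = 0) (i : Fin 3) (s : invSections n S) :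
    (dirac ρ i (mulSection (g ^ (1 + 1)) s)).1 x = 0 := by
  obtain ⟨t, ht, -⟩ := exists_dirac_mulSection_pow_succ ρ g 1 s i
  rw [ht]
  exact mulSection_pow_succ_apply hg 0 t

theorem dirac_dirac_mulSection_pow_two (hg : g.1 x = 0) (i j : Fin 3) (v : S) :
    (dirac ρ i (dirac ρ j (mulSection (g ^ 2) (constSection n v)))).1 x =
      (2 : ℂ) • symbolEnd ρ x g i (symbolEnd ρ x g j v) := by
  obtain ⟨t, ht, htx⟩ := exists_dirac_mulSection_pow_succ ρ g 1 (constSection n v) j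
  obtain ⟨u, hu, hux⟩ := exists_dirac_mulSection_pow_succ ρ g 0 t i
  rw [ht, hu, mulSection_pow_zero_apply, hux x hg, htx x hg, map_smul, smul_smul]
  norm_num [constSection]

theorem dirac_dirac_mulSection_pow_three (hg : g.1 x = 0) (i j : Fin 3) (s : invSections n S) :
    (dirac ρ i (dirac ρ j (mulSection (g ^ (2 + 1)) s))).1 x = 0 := by
  obtain ⟨t, ht, -⟩ := exists_dirac_mulSection_pow_succ ρ g 2 s j
  rw [ht]
  exact dirac_mulSection_pow_two hg i t

/-- Here and for the other `D_r`: every term is a product of exactly `m` Dirac operators. Applied to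
gᵐ w at a zero of `g`, it gives m! times the corresponding product of symbols, and the factor 1/m!
cancels, so the formula of the operator is preserved. -/
theorem symbol_D₁ (hg : g.1 x = 0) : symbol (D₁ (dirac ρ)) 1 x g = D₁ (symbolEnd ρ x g) := by
  funext w r
  rw [symbol, Nat.factorial_one, Nat.cast_one, inv_one, one_smul]
  fin_cases r <;> exact dirac_mulSection_pow_one hg _ _

theorem symbol_D₃ (hg : g.1 x = 0) : symbol (D₃ (dirac ρ)) 1 x g = D₃ (symbolEnd ρ x g) := by
  funext w r
  rw [symbol, Nat.factorial_one, Nat.cast_one, inv_one, one_smul]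
  cases r <;>
  simp only [D₃, Submodule.coe_add, Submodule.coe_sub, Submodule.coe_smul, Submodule.coe_neg,
    Pi.add_apply, Pi.sub_apply, Pi.neg_apply, Pi.smul_apply, dirac_mulSection_pow_one hg]

theorem symbol_D₅ (hg : g.1 x = 0) : symbol (D₅ (dirac ρ)) 1 x g = D₅ (symbolEnd ρ x g) := by
  funext w r
  rw [symbol, Nat.factorial_one, Nat.cast_one, inv_one, one_smul]
  cases r <;>
  simp only [D₅, Submodule.coe_sub, Submodule.coe_smul, Pi.sub_apply, Pi.smul_apply,
    dirac_mulSection_pow_one hg]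

theorem symbol_D₈ (hg : g.1 x = 0) : symbol (D₈ (dirac ρ)) 1 x g = D₈ (symbolEnd ρ x g) := by
  funext w r
  rw [symbol, Nat.factorial_one, Nat.cast_one, inv_one, one_smul]
  simp only [D₈, Submodule.coe_add, Pi.add_apply, dirac_mulSection_pow_one hg]

theorem symbol_D₂ (hg : g.1 x = 0) : symbol (D₂ (dirac ρ)) 2 x g = D₂ (symbolEnd ρ x g) := by
  funext w r
  rw [symbol, inv_factorial_two_smul]
  cases r <;>
  · simp only [D₂, Submodule.coe_add, Submodule.coe_sub, Pi.add_apply, Pi.sub_apply,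
      dirac_dirac_mulSection_pow_two hg]
    module

theorem symbol_D₄ (hg : g.1 x = 0) : symbol (D₄ (dirac ρ)) 2 x g = D₄ (symbolEnd ρ x g) := by
  funext w r
  rw [symbol, inv_factorial_two_smul]
  cases r <;>
  · simp only [D₄, map_add, map_sub, map_neg, map_smul, Submodule.coe_add, Submodule.coe_sub,
      Submodule.coe_smul, Submodule.coe_neg, Pi.add_apply, Pi.sub_apply, Pi.neg_apply,
      Pi.smul_apply, dirac_dirac_mulSection_pow_two hg]
    module

theorem symbol_D₆ (hg : g.1 x = 0) : symbol (D₆ (dirac ρ)) 2 x g = D₆ (symbolEnd ρ x g) := by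
  funext w r
  rw [symbol, inv_factorial_two_smul]
  cases r <;>
  · simp only [D₆, Submodule.coe_add, Submodule.coe_sub, Submodule.coe_smul, Submodule.coe_neg,
      Pi.add_apply, Pi.sub_apply, Pi.neg_apply, Pi.smul_apply, dirac_dirac_mulSection_pow_two hg]
    module

theorem symbol_D₇ (hg : g.1 x = 0) : symbol (D₇ (dirac ρ)) 2 x g = D₇ (symbolEnd ρ x g) := by
  funext w r
  rw [symbol, inv_factorial_two_smul]
  fin_cases r <;>
  · simp only [D₇, Submodule.coe_add, Submodule.coe_sub, Pi.add_apply, Pi.sub_apply,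
      dirac_dirac_mulSection_pow_two hg, Fin.zero_eta, Fin.mk_one, Fin.reduceFinMk,
      Matrix.cons_val]
    module

end Leibniz

/-! ### The orders of the operators -/

section Order

variable {n : ℕ} {S : Type*} [NormedAddCommGroup S] [NormedSpace ℂ S]

/-- The coordinate `x_{kμ}`. -/
def coord (k : Fin 3) (μ : Fin n) : Chart n →L[ℝ] ℝ :=
  ((ContinuousLinearMap.proj μ : (Fin n → ℝ) →L[ℝ] ℝ).comp (ContinuousLinearMap.proj k)).comp
    (ContinuousLinearMap.fst ℝ _ _)

/-- The coordinate `x_{kμ}` as an invariant function. -/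
def coordFunction (k : Fin 3) (μ : Fin n) : invFunctions n :=
  ⟨coord k μ, (coord k μ).contDiff, fun r s => by
    funext x
    rw [lieDeriv, (coord k μ).fderiv]
    rfl⟩

theorem lieDeriv_coordFunction (k : Fin 3) (μ : Fin n) (x : Chart n) :
    lieDeriv (xiOne k μ) (coordFunction k μ).1 x = 1 := by
  change fderiv ℝ (coord k μ) x _ = 1
  rw [(coord k μ).fderiv]
  simp [coord, xiOne, rowVec]

variable (ρ : CliffordAlgebra (cliffordForm n) →ₐ[ℝ] Module.End ℂ S)

/-- There is an invariant function, vanishing at the origin, at which the symbol of `∂₁` is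
injective there. -/
theorem exists_symbolEnd_zero_injective (hn : 0 < n) : ∃ g : invFunctions n, g.1 0 = 0 ∧
    Function.Injective (symbolEnd ρ 0 g 0) :=
  ⟨coordFunction 0 ⟨0, hn⟩, rfl, (symbolEnd_bijective ρ (μ := ⟨0, hn⟩)
    (by rw [lieDeriv_coordFunction]; exact one_ne_zero)).1⟩

/-- Nonvanishing of the symbol is tested at one covector, the differential of a coordinate in the
first row, where the symbol of ∂₁ is injective. Below, `w` has a single nonzero entry `v`, chosen so
that some component of the symbol is a nonzero multiple of `d 0 v` or `d 0 (d 0 v)`. -/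
theorem hasOrder_of_symbol {ι κ : Type*} {D : (ι → invSections n S) → (κ → invSections n S)}
    {m : ℕ} (hn : 0 < n) (hlin : IsLinearMap ℂ D)
    (hvan : ∀ (x : Chart n) (g : invFunctions n), g.1 x = 0 → ∀ (s : ι → invSections n S) (r : κ),
      (D (fun i => mulSection (g ^ (m + 1)) (s i)) r).1 x = 0)
    (σ : (Fin 3 → Module.End ℂ S) → (ι → S) → (κ → S))
    (hσ : ∀ {x : Chart n} {g : invFunctions n}, g.1 x = 0 → symbol D m x g = σ (symbolEnd ρ x g))
    (w : ι → S) (hw : ∀ d : Fin 3 → Module.End ℂ S, Function.Injective (d 0) → σ d w ≠ 0) :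
    HasOrder D m := by
  obtain ⟨g, hg, hinj⟩ := exists_symbolEnd_zero_injective ρ hn
  exact ⟨hlin, hvan, 0, g, w, hg, by rw [hσ hg]; exact hw _ hinj⟩

variable [FiniteDimensional ℂ S] [Nontrivial S]

theorem hasOrder_D₁ (hn : 0 < n) : HasOrder (D₁ (dirac ρ)) 1 := by
  obtain ⟨v, hv⟩ := exists_ne (0 : S)
  refine hasOrder_of_symbol ρ hn (isLinearMap_D₁ _) (fun x g hg s r => ?_) D₁ symbol_D₁
    (fun _ => v) fun d hd h => hv (hd ?_)
  · fin_cases r <;> exact dirac_mulSection_pow_two hg _ _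
  · simpa [D₁] using congrFun h 0

theorem hasOrder_D₂ (hn : 0 < n) : HasOrder (D₂ (dirac ρ)) 2 := by
  obtain ⟨v, hv⟩ := exists_ne (0 : S)
  refine hasOrder_of_symbol ρ hn (isLinearMap_D₂ _) (fun x g hg s r => ?_) D₂ symbol_D₂
    (Pi.single 1 v) fun d hd h => hv (hd (hd ?_))
  · cases r <;> simp [D₂, dirac_dirac_mulSection_pow_three hg]
  · simpa [D₂] using congrFun h .h12

theorem hasOrder_D₃ (hn : 0 < n) : HasOrder (D₃ (dirac ρ)) 1 := by
  obtain ⟨v, hv⟩ := exists_ne (0 : S)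
  refine hasOrder_of_symbol ρ hn (isLinearMap_D₃ _) (fun x g hg s r => ?_) D₃ symbol_D₃
    (fun | .h21 => v | _ => 0) fun d hd h => hv (hd ?_)
  · cases r <;> simp [D₃, dirac_mulSection_pow_two hg]
  · simpa [D₃] using congrFun h .v220

theorem hasOrder_D₄ (hn : 0 < n) : HasOrder (D₄ (dirac ρ)) 2 := by
  obtain ⟨v, hv⟩ := exists_ne (0 : S)
  refine hasOrder_of_symbol ρ hn (isLinearMap_D₄ _) (fun x g hg s r => ?_) D₄ symbol_D₄
    (fun | .w1 => v | _ => 0) fun d hd h => hv (hd (hd ?_))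
  · cases r <;> simp [D₄, dirac_dirac_mulSection_pow_three hg]
  · simpa [D₄] using congrFun h .w311

theorem hasOrder_D₅ (hn : 0 < n) : HasOrder (D₅ (dirac ρ)) 1 := by
  obtain ⟨v, hv⟩ := exists_ne (0 : S)
  refine hasOrder_of_symbol ρ hn (isLinearMap_D₅ _) (fun x g hg s r => ?_) D₅ symbol_D₅
    (fun | .w113 => v | _ => 0) fun d hd h => hv (hd ?_)
  · cases r <;> simp [D₅, dirac_mulSection_pow_two hg]
  · simpa [D₅] using congrFun h .h21

theorem hasOrder_D₆ (hn : 0 < n) : HasOrder (D₆ (dirac ρ)) 2 := by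
  obtain ⟨v, hv⟩ := exists_ne (0 : S)
  refine hasOrder_of_symbol ρ hn (isLinearMap_D₆ _) (fun x g hg s r => ?_) D₆ symbol_D₆
    (fun | .v022 => v | _ => 0) fun d hd h => hv (hd (hd ?_))
  · cases r <;> simp [D₆, dirac_dirac_mulSection_pow_three hg]
  · simpa [D₆] using congrFun h .w1

theorem hasOrder_D₇ (hn : 0 < n) : HasOrder (D₇ (dirac ρ)) 2 := by
  obtain ⟨v, hv⟩ := exists_ne (0 : S)
  refine hasOrder_of_symbol ρ hn (isLinearMap_D₇ _) (fun x g hg s r => ?_) D₇ symbol_D₇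
    (fun | .h12 => v | _ => 0) fun d hd h => hv (hd (hd ?_))
  · fin_cases r <;> simp [D₇, dirac_dirac_mulSection_pow_three hg]
  · simpa [D₇] using congrFun h 1

theorem hasOrder_D₈ (hn : 0 < n) : HasOrder (D₈ (dirac ρ)) 1 := by
  obtain ⟨v, hv⟩ := exists_ne (0 : S)
  refine hasOrder_of_symbol ρ hn (isLinearMap_D₈ _) (fun x g hg s r => ?_) D₈ symbol_D₈
    (Pi.single 0 v) fun d hd h => hv (hd ?_)
  · simp [D₈, dirac_mulSection_pow_two hg]
  · simpa [D₈] using congrFun h ()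

end Order

end ThreeDirac

open ThreeDirac in
theorem mainTheorem5 (n : ℕ) (hn : 6 ≤ n) {S : Type*} [NormedAddCommGroup S] [NormedSpace ℂ S]
    [FiniteDimensional ℂ S] [Nontrivial S]
    (ρ : CliffordAlgebra (cliffordForm n) →ₐ[ℝ] Module.End ℂ S) :
    -- the orders of the operators
    (HasOrder (D₁ (dirac ρ)) 1 ∧ HasOrder (D₂ (dirac ρ)) 2 ∧ HasOrder (D₃ (dirac ρ)) 1 ∧
      HasOrder (D₄ (dirac ρ)) 2 ∧ HasOrder (D₅ (dirac ρ)) 1 ∧ HasOrder (D₆ (dirac ρ)) 2 ∧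
      HasOrder (D₇ (dirac ρ)) 2 ∧ HasOrder (D₈ (dirac ρ)) 1) ∧
    -- the diagram is a complex
    ((∀ φ, D₂ (dirac ρ) (D₁ (dirac ρ) φ) = 0) ∧
      (∀ φ, D₃ (dirac ρ) (D₂ (dirac ρ) φ) = 0) ∧
      (∀ φ, D₄ (dirac ρ) (D₂ (dirac ρ) φ) = 0) ∧
      (∀ ψ, D₆ (dirac ρ) (D₃ (dirac ρ) ψ) + D₅ (dirac ρ) (D₄ (dirac ρ) ψ) = 0) ∧
      (∀ φ, D₇ (dirac ρ) (D₆ (dirac ρ) φ) = 0) ∧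
      (∀ ψ, D₇ (dirac ρ) (D₅ (dirac ρ) ψ) = 0) ∧
      (∀ φ, D₈ (dirac ρ) (D₇ (dirac ρ) φ) = 0)) ∧
    -- the symbol sequence is exact at every nonzero element of the dual of the distribution
    (∀ (x : Chart n) (g : invFunctions n), g.1 x = 0 →
      (∃ X ∈ horizontal x, fderiv ℝ g.1 x X ≠ 0) →
      Function.Injective (symbol (D₁ (dirac ρ)) 1 x g) ∧
      Function.Exact (symbol (D₁ (dirac ρ)) 1 x g) (symbol (D₂ (dirac ρ)) 2 x g) ∧
      Function.Exact (symbol (D₂ (dirac ρ)) 2 x g)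
        (fun w => (symbol (D₃ (dirac ρ)) 1 x g w, symbol (D₄ (dirac ρ)) 2 x g w)) ∧
      Function.Exact (fun w => (symbol (D₃ (dirac ρ)) 1 x g w, symbol (D₄ (dirac ρ)) 2 x g w))
        (fun u => symbol (D₆ (dirac ρ)) 2 x g u.1 + symbol (D₅ (dirac ρ)) 1 x g u.2) ∧
      Function.Exact
        (fun u : (Basis4 → S) × (Basis5 → S) =>
          symbol (D₆ (dirac ρ)) 2 x g u.1 + symbol (D₅ (dirac ρ)) 1 x g u.2)
        (symbol (D₇ (dirac ρ)) 2 x g) ∧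
      Function.Exact (symbol (D₇ (dirac ρ)) 2 x g) (symbol (D₈ (dirac ρ)) 1 x g) ∧
      Function.Surjective (symbol (D₈ (dirac ρ)) 1 x g)) := by
  have hn0 : 0 < n := by lia
  have hc := centralAnticomm_dirac ρ
  refine ⟨⟨hasOrder_D₁ ρ hn0, hasOrder_D₂ ρ hn0, hasOrder_D₃ ρ hn0, hasOrder_D₄ ρ hn0,
    hasOrder_D₅ ρ hn0, hasOrder_D₆ ρ hn0, hasOrder_D₇ ρ hn0, hasOrder_D₈ ρ hn0⟩,
    ⟨D₂_comp_D₁ hc, D₃_comp_D₂ hc, D₄_comp_D₂ hc, D₆_comp_D₃_add_D₅_comp_D₄ hc, D₇_comp_D₆ hc,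
      D₇_comp_D₅ hc, D₈_comp_D₇ hc⟩, fun x g hg hX => ?_⟩
  obtain ⟨k, μ, hkμ⟩ := exists_xiOne_ne_zero hX
  have hk := symbolEnd_bijective ρ hkμ
  have hs := centralAnticomm_symbolEnd ρ x g
  -- From here on the symbol sequence is the formal complex at `symbolEnd ρ x g`, whose k-th member
  -- is bijective.
  rw [symbol_D₁ hg, symbol_D₂ hg, symbol_D₃ hg, symbol_D₄ hg, symbol_D₅ hg, symbol_D₆ hg,
    symbol_D₇ hg, symbol_D₈ hg]
  exact ⟨injective_D₁ hk, exact_D₁_D₂ hs hk, exact_D₂_D₃_D₄ hs hk, exact_D₃_D₄_D₆_D₅ hs hk,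
    exact_D₆_D₅_D₇ hs hk, exact_D₇_D₈ hs hk, surjective_D₈ hk⟩
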